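/- For a Polish group $G$, let $E(G)$ be the equivalence relation on $G^{\omega}$ (with the product topology) given by $x\,E(G)\,y$ if and only if the sequence $x(n)y(n)^{-1}$ converges in $G$. For equivalence relations $E,F$ on Polish spaces $X,Y$, write $E\leq_B F$ if there is a Borel map $\theta:X\to Y$ with $x\,E\,y\iff\theta(x)\,F\,\theta(y)$ for all $x,y\in X$, and write $E<_B F$ if $E\leq_B F$ and $F\not\leq_B E$. Let $G_0$ denote the connected component of the identity of $G$, and let $\mathrm{Inn}_G(G_0)=\{\iota_u:u\in G\}$, where $\iota_u:G_0\to G_0$, $\iota_u(g)=ugu^{-1}$. For a countable subgroup $\Lambda$ of $\mathrm{GL}(2,\mathbb R)$, let $\Lambda\ltimes\mathbb R^2$ be the set $\Lambda\times\mathbb R^2$ with the operation $(A,s)(B,t)=(AB,s+At)$ and the product topology, where $\Lambda$ is discrete and $\mathbb R^2$ has its usual topology. Put $$R(t)=\begin{pmatrix}\cos(2\pi t)&-\sin(2\pi t)\\ \sin(2\pi t)&\cos(2\pi t)\end{pmatrix}\quad(t\in\mathbb R),$$ $\Gamma^z=\{R(\sqrt2\,n):n\in\mathbb Z\}$ and,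 for an integer $k\geq 2$, $\Gamma_k=\{R(i/k):0\le i\leq k\}$. **Theorem.** Let $k\geq 2$, $G=\Gamma_k\ltimes\mathbb R^2$ and $H=\Gamma^z\ltimes\mathbb R^2$. Then $E(G)<_B E(H)$, but there is no topological group isomorphism $\phi:G_0\to H_0$ such that $\phi\,\mathrm{Inn}_G(G_0)\,\phi^{-1}\subseteq\mathrm{Inn}_H(H_0)$. -/

import Mathlib

namespace RigidTSI

open Filter Topology Matrix

noncomputable section

/-! ### Borel reducibility and the equivalence relation `E(G)` -/

/-- `E ≤_B F`: there is a Borel map `θ` (with respect to the Borel σ-algebras of the two topologies)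
such that `x E y ↔ θ x F θ y`. -/
def BorelReducible {X Y : Type*} [TopologicalSpace X] [TopologicalSpace Y]
    (E : Setoid X) (F : Setoid Y) : Prop :=
  ∃ θ : X → Y, @Measurable X Y (borel X) (borel Y) θ ∧ ∀ x y : X, E x y ↔ F (θ x) (θ y)

/-- `E <_B F`: `E ≤_B F` and not `F ≤_B E`. -/
def StrictBorelReducible {X Y : Type*} [TopologicalSpace X] [TopologicalSpace Y]
    (E : Setoid X) (F : Setoid Y) : Prop :=
  BorelReducible E F ∧ ¬ BorelReducible F E

/-- The equivalence relation `E(G)` on `G^ω`: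
`x E(G) y` iff the sequence `x(n) y(n)⁻¹` converges in `G`. -/
def inducedEquiv (G : Type*) [Group G] [TopologicalSpace G] [IsTopologicalGroup G] :
    Setoid (ℕ → G) where
  r x y := ∃ g : G, Tendsto (fun n => x n * (y n)⁻¹) atTop (𝓝 g)
  iseqv :=
    { refl := fun x => ⟨1, by simpa using tendsto_const_nhds⟩
      symm := by
        rintro x y ⟨g, hg⟩
        exact ⟨g⁻¹, by simpa using hg.inv⟩
      trans := by
        rintro x y z ⟨g, hg⟩ ⟨h, hh⟩
        exact ⟨g * h, by simpa [mul_assoc] using hg.mul hh⟩ }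

/-! ### The identity component and the automorphisms induced by conjugation -/

instance connectedComponentOfOne_normal (G : Type*) [Group G] [TopologicalSpace G]
    [IsTopologicalGroup G] : (Subgroup.connectedComponentOfOne G).Normal where
  conj_mem n hn g := by
    have hc : Continuous fun x : G => g * x * g⁻¹ := by fun_prop
    have h := hc.mapsTo_connectedComponent (1 : G) hn
    rw [mul_one, mul_inv_cancel] at h
    exact h

/-- The topological group automorphism `ι_u : N → N`, `ι_u(g) = u g u⁻¹`. -/
def conjAut {G : Type*} [Group G] [TopologicalSpace G] [IsTopologicalGroup G]
    (N : Subgroup G) [N.Normal] (u : G) : N ≃ₜ* N where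
  toMulEquiv := MulAut.conjNormal u
  continuous_toFun := by
    refine Continuous.subtype_mk (f := fun x : N => u * (x : G) * u⁻¹) ?_ _
    fun_prop
  continuous_invFun := by
    refine Continuous.subtype_mk (f := fun x : N => u⁻¹ * (x : G) * u⁻¹⁻¹) ?_ _
    fun_prop

/-- `Inn_G(N) = {ι_u : u ∈ G}`. -/
def Inn {G : Type*} [Group G] [TopologicalSpace G] [IsTopologicalGroup G]
    (N : Subgroup G) [N.Normal] : Set (N ≃ₜ* N) :=
  Set.range (conjAut N)

/-! ### Semidirect products `Λ ⋉ ℝ²` -/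

/-- The action of a subgroup `Λ` of `GL(2, ℝ)` on the additive group `ℝ²`, `A ↦ (t ↦ A t)`. -/
def linearAction (Λ : Subgroup (GL (Fin 2) ℝ)) : Λ →* MulAut (Multiplicative (Fin 2 → ℝ)) where
  toFun A :=
    { toFun := fun t => Multiplicative.ofAdd ((A : GL (Fin 2) ℝ).val *ᵥ t.toAdd)
      invFun := fun t => Multiplicative.ofAdd ((A⁻¹ : GL (Fin 2) ℝ).val *ᵥ t.toAdd)
      left_inv := fun t => by
        simp only [toAdd_ofAdd, mulVec_mulVec, ← Units.val_mul, inv_mul_cancel, Units.val_one,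
          one_mulVec, ofAdd_toAdd]
      right_inv := fun t => by
        simp only [toAdd_ofAdd, mulVec_mulVec, ← Units.val_mul, mul_inv_cancel, Units.val_one,
          one_mulVec, ofAdd_toAdd]
      map_mul' := fun s t => by simp only [toAdd_mul, mulVec_add, ofAdd_add] }
  map_one' := by ext t : 1; simp
  map_mul' A B := by
    ext t : 1
    exact congrArg Multiplicative.ofAdd (mulVec_mulVec t.toAdd A.1.val B.1.val).symm

/-- The group `Λ ⋉ ℝ²`: pairs `(λ, t)` with `(λ₁, t₁)(λ₂, t₂) = (λ₁ λ₂, t₁ + λ₁ t₂)`. -/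
def PlaneSemi (Λ : Subgroup (GL (Fin 2) ℝ)) : Type :=
  Multiplicative (Fin 2 → ℝ) ⋊[linearAction Λ] Λ

instance planeSemiGroup (Λ : Subgroup (GL (Fin 2) ℝ)) : Group (PlaneSemi Λ) :=
  inferInstanceAs (Group (Multiplicative (Fin 2 → ℝ) ⋊[linearAction Λ] Λ))

/-- The product topology on `Λ × ℝ²`, where `Λ` is discrete and `ℝ²` has its usual topology. -/
instance planeSemiTopology (Λ : Subgroup (GL (Fin 2) ℝ)) : TopologicalSpace (PlaneSemi Λ) :=
  TopologicalSpace.induced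
    (fun x : PlaneSemi Λ => (SemidirectProduct.right x, SemidirectProduct.left x))
    (@instTopologicalSpaceProd Λ (Multiplicative (Fin 2 → ℝ)) ⊥ inferInstance)

instance planeSemi_isTopologicalGroup (Λ : Subgroup (GL (Fin 2) ℝ)) :
    IsTopologicalGroup (PlaneSemi Λ) := by
  let : TopologicalSpace Λ := ⊥
  have : DiscreteTopology Λ := ⟨rfl⟩
  have hp : Continuous fun x : PlaneSemi Λ =>
      ((SemidirectProduct.right x, SemidirectProduct.left x) :
        Λ × Multiplicative (Fin 2 → ℝ)) := continuous_induced_dom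
  have hr : Continuous fun x : PlaneSemi Λ => (SemidirectProduct.right x : Λ) := hp.fst
  have hl : Continuous fun x : PlaneSemi Λ =>
      Multiplicative.toAdd (SemidirectProduct.left x) := continuous_toAdd.comp hp.snd
  have hm : Continuous fun A : Λ => (A : GL (Fin 2) ℝ).val := continuous_of_discreteTopology
  have hm' : Continuous fun A : Λ => ((A⁻¹ : Λ) : GL (Fin 2) ℝ).val :=
    continuous_of_discreteTopology
  have hmul : Continuous fun p : Λ × Λ => p.1 * p.2 := continuous_of_discreteTopology
  have hinv : Continuous fun A : Λ => A⁻¹ := continuous_of_discreteTopology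
  refine { continuous_mul := ?_, continuous_inv := ?_ }
  · refine continuous_induced_rng.2 (Continuous.prodMk ?_ ?_)
    · exact hmul.comp ((hr.comp continuous_fst).prodMk (hr.comp continuous_snd))
    · exact continuous_ofAdd.comp ((hl.comp continuous_fst).add
        (((hm.comp hr).comp continuous_fst).matrix_mulVec (hl.comp continuous_snd)))
  · refine continuous_induced_rng.2 (Continuous.prodMk ?_ ?_)
    · exact hinv.comp hr
    · exact continuous_ofAdd.comp ((hm'.comp hr).matrix_mulVec hl.neg)

/-! ### The rotation groups -/

/-- The rotation matrix `rot t` of angle `2πt`. -/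
def rotMatrix (t : ℝ) : Matrix (Fin 2) (Fin 2) ℝ :=
  !![Real.cos (2 * Real.pi * t), -Real.sin (2 * Real.pi * t);
     Real.sin (2 * Real.pi * t), Real.cos (2 * Real.pi * t)]

theorem rotMatrix_zero : rotMatrix 0 = 1 := by
  simp [rotMatrix, Matrix.one_fin_two]

theorem rotMatrix_add (s t : ℝ) : rotMatrix (s + t) = rotMatrix s * rotMatrix t := by
  simp only [rotMatrix, mul_add, Real.cos_add, Real.sin_add, Matrix.mul_fin_two]
  congr 1
  ring_nf

/-- `rot t` as an element of `GL(2, ℝ)`, with inverse `rot (-t)`. -/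
def rot (t : ℝ) : GL (Fin 2) ℝ where
  val := rotMatrix t
  inv := rotMatrix (-t)
  val_inv := by rw [← rotMatrix_add, add_neg_cancel, rotMatrix_zero]
  inv_val := by rw [← rotMatrix_add, neg_add_cancel, rotMatrix_zero]

theorem rot_zero : rot 0 = 1 := Units.ext rotMatrix_zero

theorem rot_add (s t : ℝ) : rot (s + t) = rot s * rot t := Units.ext (rotMatrix_add s t)

theorem rot_neg (t : ℝ) : rot (-t) = (rot t)⁻¹ := Units.ext rfl

theorem rot_add_intCast (t : ℝ) (n : ℤ) : rot (t + n) = rot t := by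
  have h : 2 * Real.pi * (t + n) = 2 * Real.pi * t + n * (2 * Real.pi) := by ring
  refine Units.ext ?_
  simp only [rot, rotMatrix, h, Real.cos_add_int_mul_two_pi, Real.sin_add_int_mul_two_pi]

theorem exists_le_rot_div (k : ℕ) (m : ℤ) : ∃ i : ℕ, i ≤ k ∧ rot (m / k) = rot (i / k) := by
  rcases Nat.eq_zero_or_pos k with rfl | hk
  · exact ⟨0, le_rfl, by simp⟩
  · have hk' : (0 : ℤ) < k := by exact_mod_cast hk
    have hk0 : (k : ℝ) ≠ 0 := by positivity
    have h0 := Int.emod_nonneg m hk'.ne'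
    have h1 := Int.emod_lt_of_pos m hk'
    refine ⟨(m % k).toNat, by omega, ?_⟩
    have hc : (((m % k).toNat : ℕ) : ℝ) = ((m % k : ℤ) : ℝ) := by
      exact_mod_cast congrArg (Int.cast : ℤ → ℝ) (Int.toNat_of_nonneg h0)
    have hd : (m : ℝ) = ((m % k : ℤ) : ℝ) + k * ((m / k : ℤ) : ℝ) := by
      exact_mod_cast (Int.emod_add_mul_ediv m k).symm
    rw [hc, ← rot_add_intCast (((m % k : ℤ) : ℝ) / k) (m / k)]
    congr 1
    rw [hd]
    field_simp

/-- `Γ_k = {rot (i/k) : i ≤ k}`, the rotations by the multiples of the angle `2π/k`. -/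
def GammaFin (k : ℕ) : Subgroup (GL (Fin 2) ℝ) where
  carrier := {A | ∃ i : ℕ, i ≤ k ∧ A = rot (i / k)}
  one_mem' := ⟨0, Nat.zero_le k, by simp [rot_zero]⟩
  mul_mem' := by
    rintro _ _ ⟨i, -, rfl⟩ ⟨j, -, rfl⟩
    obtain ⟨l, hl, h⟩ := exists_le_rot_div k (i + j)
    refine ⟨l, hl, ?_⟩
    rw [← h, ← rot_add]
    push_cast
    rw [add_div]
  inv_mem' := by
    rintro _ ⟨i, -, rfl⟩
    obtain ⟨l, hl, h⟩ := exists_le_rot_div k (-i)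
    refine ⟨l, hl, ?_⟩
    rw [← h, ← rot_neg]
    push_cast
    rw [neg_div]

/-- `Γ^z = {rot (√2 n) : n ∈ ℤ}`, the rotations by the multiples of the angle `2π√2`. -/
def GammaZ : Subgroup (GL (Fin 2) ℝ) where
  carrier := {A | ∃ n : ℤ, A = rot (√2 * n)}
  one_mem' := ⟨0, by simp [rot_zero]⟩
  mul_mem' := by
    rintro _ _ ⟨m, rfl⟩ ⟨n, rfl⟩
    exact ⟨m + n, by rw [← rot_add]; push_cast; rw [mul_add]⟩
  inv_mem' := by
    rintro _ ⟨n, rfl⟩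
    exact ⟨-n, by rw [← rot_neg]; push_cast; rw [mul_neg]⟩

end

end RigidTSI

open RigidTSI

/-! In complex coordinates, an element of a group `Λ ⋉ ℝ²` of rotations and translations is a pair
(ρ, τ) with |ρ| = 1. Two sequences are equivalent iff their rotation parts eventually differ by one
constant factor ζ and τ(x n) - ζ τ(y n) converges (`IsRotationGroup.inducedEquiv_iff`).

Reduction. The multiples of √2 are dense modulo 1, so each successive quotient of the rotation parts
of x can be replaced by an element of `GammaZ` with error at most 2⁻ⁿ. The accumulated error F(x, n)
is a convergent unimodular sequence, and multiplying both coordinates of x(n) by it gives the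
reduction. Nothing is lost on the way back, because a convergent sequence of k-th roots of unity is
eventually constant.

Non-reduction. Pull a supposed Borel reduction back along sequences from a countable discrete group
Γ mapping to `PlaneSemi GammaZ`, with c going to the rotation by ω = `unitExp √2` and σ n to the
translation by √n. Continuity on a comeager set and a Baire category fusion (`exists_fusion`) make
the map local: where two arguments agree on an interval, the quotient of their images is nearly
constant on a corresponding interval (`Controlled.nearConst_of_agree`). Now let an argument walk
through σ 0, σ 1, ... with sparse jumps. Since √(n+1) - √n → 0, shifting the jumps gives an
equivalent sequence, and right multiplication by a background z does not affect this. The image of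
the walk relative to that of z changes only near the jumps, and locality lets it see z only there.
On a background running cyclically through c^p, p < N, the jumps can be placed inside the
c^p-windows for any chosen p. Hence one and the same image path is, up to a k-th root of unity and a
convergent error, the path of the walk on the constant background c^p, that is, of its conjugate by
c^(-p) (`Controlled.exists_tendsto_walk_sub`). With more values of p than pairs of k-th roots of
unity, two conjugates p ≠ q have equivalent images. Their arguments are not equivalent: the
translations differ by (ω^(-p) - ω^(-q))√n, which is unbounded because ω is not a root of unity
(`Controlled.false`).

Isomorphisms. Conjugation acts on the identity component ℝ² through the rotation part. The
nontrivial action of order dividing k coming from `GammaFin k` would have to match one from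
`GammaZ`, which has no nontrivial torsion. -/

namespace RigidTSI

open Filter Topology Matrix

noncomputable section

/-! ### Borel maps on Baire spaces -/

/-- A Borel map into a second countable space is continuous on a dense `Gδ` set. -/
theorem exists_dense_open_continuousOn {X Y : Type*} [TopologicalSpace X] [BaireSpace X]
    [TopologicalSpace Y] [SecondCountableTopology Y] {f : X → Y}
    (hf : @Measurable X Y (borel X) (borel Y) f) :
    ∃ O : ℕ → Set X, (∀ i, IsOpen (O i)) ∧ (∀ i, Dense (O i)) ∧ ContinuousOn f (⋂ i, O i) := by
  borelize X
  borelize Y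
  have hU : ∀ b ∈ TopologicalSpace.countableBasis Y,
      ∃ u : Set X, IsOpen u ∧ f ⁻¹' b =ᶠ[residual X] u := fun b hb =>
    (hf ((TopologicalSpace.isOpen_of_mem_countableBasis hb).measurableSet)).residualEq_isOpen
  choose! U hUo hUe using hU
  have hQ : {x : X | ∀ b ∈ TopologicalSpace.countableBasis Y, (x ∈ f ⁻¹' b ↔ x ∈ U b)}
      ∈ residual X := by
    refine (eventually_countable_ball (TopologicalSpace.countable_countableBasis Y)).2 ?_
    intro b hb
    filter_upwards [hUe b hb] with x hx
    exact iff_of_eq hx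
  obtain ⟨t, htQ, htG, htd⟩ := mem_residual.1 hQ
  obtain ⟨O, hO, rfl⟩ := isGδ_iff_eq_iInter_nat.1 htG
  refine ⟨O, hO, fun i => htd.mono (Set.iInter_subset _ i), ?_⟩
  intro x hx
  refine ((TopologicalSpace.isBasis_countableBasis Y).nhds_hasBasis).tendsto_right_iff.2 ?_
  rintro b ⟨hb, hxb⟩
  have hxU : x ∈ U b := (htQ hx b hb).1 hxb
  filter_upwards [mem_nhdsWithin_of_mem_nhds ((hUo b hb).mem_nhds hxU), self_mem_nhdsWithin]
    with y hyU hyQ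
  exact (htQ hyQ b hb).2 hyU

/-! ### Fusion along a generic sequence -/

section Fusion

variable {Γ : Type*} [TopologicalSpace Γ] [DiscreteTopology Γ]

theorem exists_agree_subset_of_mem_nhds {z : ℕ → Γ} {U : Set (ℕ → Γ)} (hU : U ∈ 𝓝 z) :
    ∃ N, ∀ w : ℕ → Γ, (∀ i < N, w i = z i) → w ∈ U := by
  obtain ⟨_, ⟨x, n, rfl⟩, hz, hs⟩ :=
    (PiNat.isTopologicalBasis_cylinders (fun _ : ℕ => Γ)).mem_nhds_iff.1 hU
  refine ⟨n, fun w hw => hs fun i hi => ?_⟩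
  rw [hw i hi, hz i hi]

/-- Near a generic point the first `l` values of `Θ` oscillate by at most `ε`. -/
theorem eventually_small_oscillation {G : Type*} [TopologicalSpace G] {Θ : (ℕ → Γ) → ℕ → G} {O : ℕ → Set (ℕ → Γ)}
    (hO : ∀ i, IsOpen (O i)) (hOd : ∀ i, Dense (O i)) (hΘ : ContinuousOn Θ (⋂ i, O i))
    {d : G × G → ℝ} (hd : Continuous d) (hd0 : ∀ g, d (g, g) = 0) (l : ℕ)
    {ε : ℝ} (hε : 0 < ε) :
    ∀ᶠ z in residual (ℕ → Γ), ∃ N, ∀ u v : ℕ → Γ, (∀ i < N, u i = z i) → (∀ i < N, v i = z i) →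
      u ∈ ⋂ i, O i → v ∈ ⋂ i, O i → ∀ m ≤ l, d (Θ u m, Θ v m) ≤ ε := by
  have hres : ⋂ i, O i ∈ residual (ℕ → Γ) :=
    countable_iInter_mem.2 fun i => residual_of_dense_open (hO i) (hOd i)
  filter_upwards [hres] with z hz
  have key : ∀ m, ∃ N, ∀ u v : ℕ → Γ, (∀ i < N, u i = z i) → (∀ i < N, v i = z i) →
      u ∈ ⋂ i, O i → v ∈ ⋂ i, O i → d (Θ u m, Θ v m) ≤ ε := by
    intro m
    have hc : Tendsto (fun u => Θ u m) (𝓝[⋂ i, O i] z) (𝓝 (Θ z m)) :=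
      ((continuous_apply m).comp_continuousOn hΘ) z hz
    have hV : {p : G × G | d p < ε} ∈ 𝓝 (Θ z m, Θ z m) :=
      (isOpen_lt hd continuous_const).mem_nhds (by simpa [hd0] using hε)
    obtain ⟨V, hV, V', hV', hVs⟩ := mem_nhds_prod_iff.1 hV
    obtain ⟨U, hU, hUs⟩ := mem_nhdsWithin_iff_exists_mem_nhds_inter.1 (hc (inter_mem hV hV'))
    obtain ⟨N, hN⟩ := exists_agree_subset_of_mem_nhds hU
    refine ⟨N, fun u v hu hv huQ hvQ => ?_⟩
    have h1 := hUs ⟨hN u hu, huQ⟩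
    have h2 := hUs ⟨hN v hv, hvQ⟩
    have h3 : (Θ u m, Θ v m) ∈ {p : G × G | d p < ε} := hVs ⟨h1.1, h2.2⟩
    exact le_of_lt h3
  choose N hN using key
  refine ⟨(Finset.range (l + 1)).sup N, fun u v hu hv huQ hvQ m hm => hN m u v ?_ ?_ huQ hvQ⟩ <;>
  · intro i hi
    have : N m ≤ (Finset.range (l + 1)).sup N := Finset.le_sup (f := N) (by simp; omega)
    first | exact hu i (by omega) | exact hv i (by omega)

variable [Group Γ]

theorem eventually_residual_mul {p : (ℕ → Γ) → Prop} (h : ∀ᶠ z in residual (ℕ → Γ), p z)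
    (g : ℕ → Γ) : ∀ᶠ z in residual (ℕ → Γ), p (g * z) := by
  have := (Homeomorph.mulLeft g).residual_map_eq
  rw [← this] at h
  exact h

variable {G : Type*} [Group G] [TopologicalSpace G] [IsTopologicalGroup G]

/-- If `Θ` is continuous on the dense `Gδ` set `⋂ O i` and `Θ (g w) / Θ (h w)` always converges, then
for generic `z` the convergence is uniform, up to `ε`, on a neighbourhood of `z`. -/
theorem eventually_uniform_cauchy {Θ : (ℕ → Γ) → ℕ → G} {O : ℕ → Set (ℕ → Γ)}
    (hO : ∀ i, IsOpen (O i)) (hOd : ∀ i, Dense (O i)) (hΘ : ContinuousOn Θ (⋂ i, O i))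
    {d : G × G → ℝ} (hd : Continuous d) (hd0 : ∀ g, d (g, g) = 0) (g h : ℕ → Γ)
    (hconv : ∀ w, ∃ a, Tendsto (fun m => Θ (g * w) m * (Θ (h * w) m)⁻¹) atTop (𝓝 a))
    {ε : ℝ} (hε : 0 < ε) :
    ∀ᶠ z in residual (ℕ → Γ), ∃ N l, ∀ w : ℕ → Γ, (∀ i < N, w i = z i) →
      g * w ∈ ⋂ i, O i → h * w ∈ ⋂ i, O i → ∀ m ≥ l, ∀ m' ≥ l,
        d (Θ (g * w) m * (Θ (h * w) m)⁻¹, Θ (g * w) m' * (Θ (h * w) m')⁻¹) ≤ ε := by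
  set Q : Set (ℕ → Γ) := {w | g * w ∈ ⋂ i, O i ∧ h * w ∈ ⋂ i, O i} with hQ
  set r : (ℕ → Γ) → ℕ → G := fun w m => Θ (g * w) m * (Θ (h * w) m)⁻¹ with hr
  set B : ℕ → Set (ℕ → Γ) := fun l => {w | w ∈ Q ∧ ∀ m ≥ l, ∀ m' ≥ l, d (r w m, r w m') ≤ ε} with hB
  have hrc : ∀ m, ContinuousOn (fun w => r w m) Q := by
    intro m
    have h1 : ContinuousOn (fun w => Θ (g * w)) Q :=
      hΘ.comp (Continuous.continuousOn (by fun_prop)) fun w hw => hw.1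
    have h2 : ContinuousOn (fun w => Θ (h * w)) Q :=
      hΘ.comp (Continuous.continuousOn (by fun_prop)) fun w hw => hw.2
    exact ((continuous_apply m).comp_continuousOn h1).mul
      ((continuous_apply m).comp_continuousOn h2).inv
  -- `B l` is relatively closed in `Q`
  have hcl : ∀ l w, w ∈ closure (B l) → w ∈ Q → w ∈ B l := by
    intro l w hw hwQ
    refine ⟨hwQ, fun m hm m' hm' => ?_⟩
    have hc : ContinuousWithinAt (fun w => d (r w m, r w m')) Q w :=
      (hd.comp_continuousOn ((hrc m).prodMk (hrc m'))) w hwQ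
    have : (𝓝[B l] w).NeBot := mem_closure_iff_nhdsWithin_neBot.1 hw
    have hsub : B l ⊆ Q := fun v hv => hv.1
    refine le_of_tendsto (hc.mono_left (nhdsWithin_mono w hsub)) ?_
    filter_upwards [self_mem_nhdsWithin] with v hv
    exact hv.2 m hm m' hm'
  have hcov : ∀ w ∈ Q, ∃ l, w ∈ B l := by
    intro w hw
    obtain ⟨a, ha⟩ := hconv w
    have h1 : Tendsto (fun p : ℕ × ℕ => d (r w p.1, r w p.2)) (atTop ×ˢ atTop) (𝓝 0) := by
      rw [← hd0 a]
      exact (hd.tendsto (a, a)).comp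
        ((ha.comp tendsto_fst).prodMk_nhds (ha.comp tendsto_snd))
    rw [prod_atTop_atTop_eq] at h1
    obtain ⟨⟨l, l'⟩, hl⟩ := eventually_atTop.1 (h1.eventually_lt_const hε)
    exact ⟨max l l', hw, fun m hm m' hm' =>
      (hl (m, m') ⟨(le_max_left _ _).trans hm, (le_max_right _ _).trans hm'⟩).le⟩
  have hdO : ∀ (i : ℕ) (a : ℕ → Γ), Dense ((fun w => a * w) ⁻¹' O i) := fun i a =>
    (hOd i).preimage (Homeomorph.mulLeft a).isOpenMap
  have hdense : Dense (⋃ l, interior (closure (B l))) := by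
    -- The Baire theorem is applied to the whole space instead of `Q`: the closures of the `B l`
    -- cover `Q`, and the complement of `Q` is covered by translates of the closed nowhere dense
    -- sets `(O i)ᶜ`, which contribute no interior.
    let F : ℕ ⊕ (ℕ × Bool) → Set (ℕ → Γ) := Sum.elim (fun l => closure (B l))
      (fun p => ((fun w => (cond p.2 g h) * w) ⁻¹' O p.1)ᶜ)
    have hF : Dense (⋃ s, interior (F s)) := by
      refine dense_iUnion_interior_of_closed ?_ ?_
      · rintro (l | p)
        · exact isClosed_closure
        · exact ((hO p.1).preimage (by fun_prop)).isClosed_compl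
      · refine Set.eq_univ_of_forall fun w => Set.mem_iUnion.2 ?_
        by_cases hw : w ∈ Q
        · obtain ⟨l, hl⟩ := hcov w hw
          exact ⟨Sum.inl l, subset_closure hl⟩
        · rw [hQ, Set.mem_ofPred_eq, not_and_or, Set.mem_iInter, Set.mem_iInter, not_forall,
            not_forall] at hw
          rcases hw with ⟨i, hi⟩ | ⟨i, hi⟩
          · exact ⟨Sum.inr (i, true), hi⟩
          · exact ⟨Sum.inr (i, false), hi⟩
    refine hF.mono (Set.iUnion_subset ?_)
    rintro (l | p)
    · exact Set.subset_iUnion (fun l => interior (closure (B l))) l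
    · have : interior (F (Sum.inr p)) = ∅ := (hdO p.1 _).interior_compl
      rw [this]
      exact Set.empty_subset _
  have hres := residual_of_dense_open (isOpen_iUnion fun l => isOpen_interior) hdense
  filter_upwards [hres] with z hz
  obtain ⟨l, hl⟩ := Set.mem_iUnion.1 hz
  obtain ⟨N, hN⟩ := exists_agree_subset_of_mem_nhds (isOpen_interior.mem_nhds hl)
  exact ⟨N, l, fun w hw hg hh m hm m' hm' =>
    (hcl l w (interior_subset (hN w hw)) ⟨hg, hh⟩).2 m hm m' hm'⟩

variable [Countable Γ]

/-- For generic `z`, every stage of the fusion can be carried out: coordinates in `[n, n')` are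
multiplied by a common element of `K j`, those below `n` by arbitrary elements of `K j`. -/
theorem eventually_exists_stage {Θ : (ℕ → Γ) → ℕ → G} {O : ℕ → Set (ℕ → Γ)}
    (hO : ∀ i, IsOpen (O i)) (hOd : ∀ i, Dense (O i)) (hΘ : ContinuousOn Θ (⋂ i, O i))
    {d : G × G → ℝ} (hd : Continuous d) (hd0 : ∀ g, d (g, g) = 0)
    (hconv : ∀ u v : ℕ → Γ, (∀ᶠ i in atTop, u i = v i) →
      ∃ a, Tendsto (fun m => Θ u m * (Θ v m)⁻¹) atTop (𝓝 a))
    (K : Finset Γ) (U : Set (ℕ → Γ)) (hU : IsOpen U) (hUd : Dense U) {ε : ℝ} (hε : 0 < ε)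
    (n l : ℕ) :
    ∀ᶠ z in residual (ℕ → Γ), ∃ n' l', n < n' ∧ l < l' ∧
      ∀ a ∈ K, ∀ g : ℕ → Γ, (∀ i < n, g i ∈ K) → (∀ i, n ≤ i → g i = a) →
      ∀ u : ℕ → Γ, (∀ i < n', u i = g i * z i) → u ∈ U ∧ (u ∈ ⋂ i, O i →
        (∀ v ∈ ⋂ i, O i, (∀ i < n', v i = u i) → ∀ m ≤ l, d (Θ u m, Θ v m) ≤ ε) ∧
        ∀ h : ℕ → Γ, (∀ i < n, h i ∈ K) → (∀ i, n ≤ i → h i = a) →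
        ∀ v ∈ ⋂ i, O i, (∀ i < n, v i = h i * z i) → (∀ i, n ≤ i → v i = u i) →
        ∀ m ≥ l', ∀ m' ≥ l',
          d (Θ u m * (Θ v m)⁻¹, Θ u m' * (Θ v m')⁻¹) ≤ ε) := by
  classical
  -- The admissible multipliers are encoded by finitely many pairs (values below `n`, common value
  -- afterwards), so generic conditions can be intersected over them and the bounds `N`, `l`
  -- maximised.
  let ext : (Fin n → K) → K → ℕ → Γ := fun p a i => if h : i < n then p ⟨i, h⟩ else a
  have hext : ∀ a ∈ K, ∀ g : ℕ → Γ, (∀ i < n, g i ∈ K) → (∀ i, n ≤ i → g i = a) →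
      ∃ (p : Fin n → K) (b : K), (b : Γ) = a ∧ g = ext p b := by
    intro a ha g hg hga
    refine ⟨fun i => ⟨g i, hg i i.2⟩, ⟨a, ha⟩, rfl, ?_⟩
    funext i
    by_cases hi : i < n
    · simp [ext, hi]
    · simp [ext, hi, hga i (not_lt.1 hi)]
  have e1 : ∀ᶠ z in residual (ℕ → Γ), ∀ (p : Fin n → K) (a : K), ext p a * z ∈ U :=
    eventually_countable_forall.2 fun p => eventually_countable_forall.2 fun a =>
      eventually_residual_mul (residual_of_dense_open hU hUd) _
  have e2 := eventually_countable_forall.2 fun p : Fin n → K => eventually_countable_forall.2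
    fun a : K => eventually_residual_mul
      (eventually_small_oscillation hO hOd hΘ hd hd0 l hε) (ext p a)
  have e3 := eventually_countable_forall.2 fun p : Fin n → K => eventually_countable_forall.2
    fun p' : Fin n → K => eventually_countable_forall.2 fun a : K =>
      eventually_uniform_cauchy hO hOd hΘ hd hd0 (ext p a) (ext p' a) (fun w => hconv _ _ (by
        filter_upwards [eventually_ge_atTop n] with i hi
        simp [ext, not_lt.2 hi])) hε
  filter_upwards [e1, e2, e3] with z h1 h2 h3
  have h1' : ∀ (p : Fin n → K) (a : K), ∃ N, ∀ u : ℕ → Γ, (∀ i < N, u i = ext p a i * z i) → u ∈ U :=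
    fun p a => exists_agree_subset_of_mem_nhds (hU.mem_nhds (h1 p a))
  choose N1 hN1 using h1'
  choose N2 hN2 using h2
  choose N3 L3 hN3 using h3
  let C1 := Finset.univ.sup fun q : (Fin n → K) × K => max (N1 q.1 q.2) (N2 q.1 q.2)
  let C3 := Finset.univ.sup fun q : (Fin n → K) × (Fin n → K) × K => N3 q.1 q.2.1 q.2.2
  let D3 := Finset.univ.sup fun q : (Fin n → K) × (Fin n → K) × K => L3 q.1 q.2.1 q.2.2
  have hC1 : ∀ p a, max (N1 p a) (N2 p a) ≤ C1 := fun p a =>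
    Finset.le_sup (f := fun q : (Fin n → K) × K => max (N1 q.1 q.2) (N2 q.1 q.2))
      (Finset.mem_univ (p, a))
  have hC3 : ∀ p p' a, N3 p p' a ≤ C3 := fun p p' a =>
    Finset.le_sup (f := fun q : (Fin n → K) × (Fin n → K) × K => N3 q.1 q.2.1 q.2.2)
      (Finset.mem_univ (p, p', a))
  have hD3 : ∀ p p' a, L3 p p' a ≤ D3 := fun p p' a =>
    Finset.le_sup (f := fun q : (Fin n → K) × (Fin n → K) × K => L3 q.1 q.2.1 q.2.2)
      (Finset.mem_univ (p, p', a))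
  refine ⟨n + 1 + C1 + C3, l + 1 + D3, by omega, by omega, ?_⟩
  intro a ha g hg hga u hu
  obtain ⟨p, b, rfl, rfl⟩ := hext a ha g hg hga
  have hC1' := hC1 p b
  rw [max_le_iff] at hC1'
  refine ⟨hN1 p b u fun i hi => hu i (by omega), fun huQ => ⟨?_, ?_⟩⟩
  · intro v hv huv m hm
    exact hN2 p b u v (fun i hi => hu i (by omega))
      (fun i hi => (huv i (by omega)).trans (hu i (by omega))) huQ hv m hm
  · intro h hh hha v hv hvh huv m hm m' hm'
    obtain ⟨p', b', hb', rfl⟩ := hext b ha h hh hha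
    obtain rfl : b' = b := Subtype.ext hb'
    -- Both `u` and `v` are translates of this one point near `z`, which is the form required by
    -- `eventually_uniform_cauchy`.
    set w : ℕ → Γ := (ext p b')⁻¹ * u with hw
    have hgw : ext p b' * w = u := mul_inv_cancel_left _ _
    have hhw : ext p' b' * w = v := by
      funext i
      by_cases hi : i < n
      · have := hu i (by omega)
        simp [hw, this, hvh i hi]
      · simp [hw, huv i (not_lt.1 hi), ext, hi]
    have hC := hC3 p p' b'
    have hD := hD3 p p' b'
    have := hN3 p p' b' w (fun i hi => by simp [hw, hu i (by omega)])
      (by rwa [hgw]) (by rwa [hhw]) m (by omega) m' (by omega)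
    rwa [hgw, hhw] at this

/-- Fusion: after multiplying blocks of a suitable sequence `z` by the entries of `x`, the values of
`Θ` depend in a controlled way on the tails and the heads of `x`. -/
theorem exists_fusion {Θ : (ℕ → Γ) → ℕ → G} (hG : SecondCountableTopology G)
    (hΘ : @Measurable _ _ (borel (ℕ → Γ)) (borel (ℕ → G)) Θ)
    {d : G × G → ℝ} (hd : Continuous d) (hd0 : ∀ g, d (g, g) = 0)
    (hconv : ∀ u v : ℕ → Γ, (∀ᶠ i in atTop, u i = v i) →
      ∃ a, Tendsto (fun m => Θ u m * (Θ v m)⁻¹) atTop (𝓝 a))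
    (K : ℕ → Finset Γ) (hK : Monotone K) :
    ∃ (z : ℕ → Γ) (blk l : ℕ → ℕ), Monotone blk ∧ Function.Surjective blk ∧ StrictMono l ∧
      ∀ x y : ℕ → Γ, (∀ j, x j ∈ K j) → (∀ j, y j ∈ K j) → ∀ j,
        ((∀ i ≤ j, x i = y i) → ∀ m ≤ l j,
          d (Θ (fun i => x (blk i) * z i) m, Θ (fun i => y (blk i) * z i) m) ≤ (1 / 2) ^ j) ∧
        ((∀ i, j ≤ i → x i = y i) → ∀ m ≥ l (j + 1), ∀ m' ≥ l (j + 1),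
          d (Θ (fun i => x (blk i) * z i) m * (Θ (fun i => y (blk i) * z i) m)⁻¹,
            Θ (fun i => x (blk i) * z i) m' * (Θ (fun i => y (blk i) * z i) m')⁻¹)
            ≤ (1 / 2) ^ j) := by
  obtain ⟨O, hO, hOd, hΘc⟩ := exists_dense_open_continuousOn hΘ
  -- The recursion below chooses `n` and `l` from `z`, so `z` has to be generic for every triple
  -- `(j, n, l)` beforehand; there are only countably many.
  have hz := eventually_countable_forall.2 fun j => eventually_countable_forall.2 fun n =>
    eventually_countable_forall.2 fun l => eventually_exists_stage hO hOd hΘc hd hd0 hconv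
      (K j) (O j) (hO j) (hOd j) (ε := (1 / 2) ^ j) (by positivity) n l
  obtain ⟨z, hz⟩ := (dense_of_mem_residual hz).nonempty
  choose N L hN hL hs using hz
  let st : ℕ → ℕ × ℕ := fun j => Nat.rec (0, 0) (fun j s => (N j s.1 s.2, L j s.1 s.2)) j
  let n : ℕ → ℕ := fun j => (st j).1
  let l : ℕ → ℕ := fun j => (st j).2
  have hn : StrictMono n := strictMono_nat_of_lt_succ fun j => hN j (n j) (l j)
  have hl : StrictMono l := strictMono_nat_of_lt_succ fun j => hL j (n j) (l j)
  have hn0 : n 0 = 0 := rfl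
  have hex : ∀ i, ∃ j, i < n (j + 1) := fun i => ⟨i, hn.le_apply⟩
  let blk : ℕ → ℕ := fun i => Nat.find (hex i)
  have hblk : ∀ i j, blk i = j ↔ n j ≤ i ∧ i < n (j + 1) := by
    intro i j
    rw [Nat.find_eq_iff]
    refine ⟨fun h => ⟨?_, h.1⟩, fun h => ⟨h.2, fun m hm => ?_⟩⟩
    · rcases j with _ | j
      · simp [hn0]
      · exact not_lt.1 (h.2 j (Nat.lt_succ_self j))
    · exact not_lt.2 ((hn.monotone hm).trans h.1)
  have hb1 : ∀ i, n (blk i) ≤ i ∧ i < n (blk i + 1) := fun i => (hblk i _).1 rfl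
  have hblt : ∀ i j, i < n j → blk i < j := fun i j h =>
    hn.lt_iff_lt.1 ((hb1 i).1.trans_lt h)
  have hbge : ∀ i j, n j ≤ i → j ≤ blk i := fun i j h =>
    Nat.lt_succ_iff.1 (hn.lt_iff_lt.1 (h.trans_lt (hb1 i).2))
  refine ⟨z, blk, l, ?_, fun j => ⟨n j, (hblk _ _).2 ⟨le_rfl, hn (Nat.lt_succ_self j)⟩⟩, hl, ?_⟩
  · intro i i' hi
    exact hbge _ _ ((hb1 i).1.trans hi)
  -- At stage `j` the multiplier takes arbitrary earlier values below `n j`, which lie in `K j` by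
  -- monotonicity, and the constant `x j` on block `j`: this is the input format of
  -- `eventually_exists_stage`.
  have key : ∀ x : ℕ → Γ, (∀ j, x j ∈ K j) → ∀ j, ∃ g : ℕ → Γ,
      (∀ i < n j, g i ∈ K j) ∧ (∀ i, n j ≤ i → g i = x j) ∧
      ∀ i < n (j + 1), x (blk i) * z i = g i * z i := by
    intro x hx j
    refine ⟨fun i => if i < n j then x (blk i) else x j, ?_, ?_, ?_⟩
    · intro i hi
      simp only [hi, if_true]
      exact hK (hblt i j hi).le (hx _)
    · intro i hi
      simp [not_lt.2 hi]
    · intro i hi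
      by_cases h : i < n j
      · simp [h]
      · simp [h, (hblk i j).2 ⟨not_lt.1 h, hi⟩]
  have hQ : ∀ x : ℕ → Γ, (∀ j, x j ∈ K j) → (fun i => x (blk i) * z i) ∈ ⋂ i, O i := by
    intro x hx
    refine Set.mem_iInter.2 fun j => ?_
    obtain ⟨g, h1, h2, h3⟩ := key x hx j
    exact (hs j (n j) (l j) (x j) (hx j) g h1 h2 _ h3).1
  intro x y hx hy j
  obtain ⟨g, h1, h2, h3⟩ := key x hx j
  obtain ⟨h, k1, k2, k3⟩ := key y hy j
  obtain ⟨p1, p2⟩ := (hs j (n j) (l j) (x j) (hx j) g h1 h2 _ h3).2 (hQ x hx)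
  refine ⟨fun hxy m hm => p1 _ (hQ y hy) (fun i hi => ?_) m hm, fun hxy m hm m' hm' =>
    p2 h k1 (fun i hi => ?_) _ (hQ y hy) (fun i hi => ?_) (fun i hi => ?_) m hm m' hm'⟩
  · simp [hxy (blk i) (Nat.lt_succ_iff.1 (hblt i _ hi))]
  · rw [k2 i hi, hxy j le_rfl]
  · exact k3 i (hi.trans (hn (Nat.lt_succ_self j)))
  · simp [hxy (blk i) (hbge i j hi)]

end Fusion

section

/-! ### Complex coordinates on `Λ ⋉ ℝ²` for a group `Λ` of rotations -/

/-- Every element of `Λ` is a rotation. -/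
def IsRotationGroup (Λ : Subgroup (GL (Fin 2) ℝ)) : Prop := ∀ A ∈ Λ, ∃ t, A = rot t

theorem isRotationGroup_gammaFin (k : ℕ) : IsRotationGroup (GammaFin k) := by
  rintro _ ⟨i, -, rfl⟩
  exact ⟨_, rfl⟩

theorem isRotationGroup_gammaZ : IsRotationGroup GammaZ := by
  rintro _ ⟨n, rfl⟩
  exact ⟨_, rfl⟩

/-- The unit complex number `exp (2πit)`. -/
def unitExp (t : ℝ) : ℂ := ⟨Real.cos (2 * Real.pi * t), Real.sin (2 * Real.pi * t)⟩

theorem unitExp_eq (t : ℝ) : unitExp t = Complex.exp ((2 * Real.pi * t : ℝ) * Complex.I) := by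
  rw [unitExp]
  generalize 2 * Real.pi * t = x
  rw [Complex.exp_mul_I, ← Complex.ofReal_cos, ← Complex.ofReal_sin]
  apply Complex.ext <;> simp [-Complex.ofReal_cos, -Complex.ofReal_sin]

theorem norm_unitExp (t : ℝ) : ‖unitExp t‖ = 1 := by
  rw [unitExp_eq, Complex.norm_exp_ofReal_mul_I]

theorem unitExp_zero : unitExp 0 = 1 := by simp [unitExp_eq]

theorem unitExp_add (s t : ℝ) : unitExp (s + t) = unitExp s * unitExp t := by
  rw [unitExp_eq, unitExp_eq, unitExp_eq, ← Complex.exp_add]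
  push_cast
  ring_nf

theorem unitExp_ne_zero (t : ℝ) : unitExp t ≠ 0 := by
  rw [unitExp_eq]; exact Complex.exp_ne_zero _

theorem unitExp_natCast_mul (n : ℕ) (t : ℝ) : unitExp (n * t) = unitExp t ^ n := by
  rw [unitExp_eq, unitExp_eq, ← Complex.exp_nat_mul]
  push_cast
  ring_nf

theorem unitExp_eq_one_iff (t : ℝ) : unitExp t = 1 ↔ ∃ n : ℤ, t = n := by
  rw [unitExp_eq, Complex.exp_eq_one_iff]
  have hpi : (Real.pi : ℂ) ≠ 0 := by exact_mod_cast Real.pi_ne_zero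
  refine exists_congr fun n => ⟨fun h => ?_, fun h => ?_⟩
  · have h2 : (t : ℂ) = n := by
      have hI := Complex.I_ne_zero
      push_cast at h
      have : (2 * Real.pi * Complex.I) * (t : ℂ) = (2 * Real.pi * Complex.I) * n := by
        linear_combination h
      exact mul_left_cancel₀ (by simp [hpi]) this
    exact_mod_cast h2
  · rw [h]; push_cast; ring

theorem continuous_unitExp : Continuous unitExp := by
  have : unitExp = fun t : ℝ => Complex.exp ((2 * Real.pi * t : ℝ) * Complex.I) :=
    funext unitExp_eq
  rw [this]
  fun_prop

/-- The complex number of absolute value one that corresponds to the rotation. -/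
def rotNum (A : GL (Fin 2) ℝ) : ℂ := ⟨A.val 0 0, A.val 1 0⟩

theorem rotNum_rot (t : ℝ) : rotNum (rot t) = unitExp t := rfl

theorem rot_eq_of_unitExp_eq {s t : ℝ} (h : unitExp s = unitExp t) : rot s = rot t := by
  have h1 := congrArg Complex.re h
  have h2 := congrArg Complex.im h
  simp only [unitExp] at h1 h2
  exact Units.ext (by simp [rot, rotMatrix, h1, h2])

/-- A vector of `ℝ²` as a complex number. -/
def vecNum (v : Fin 2 → ℝ) : ℂ := ⟨v 0, v 1⟩

/-- A complex number as a vector of `ℝ²`. -/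
def numVec (w : ℂ) : Fin 2 → ℝ := ![w.re, w.im]

theorem vecNum_numVec (w : ℂ) : vecNum (numVec w) = w := by
  apply Complex.ext <;> simp [vecNum, numVec]

theorem numVec_vecNum (v : Fin 2 → ℝ) : numVec (vecNum v) = v := by
  ext i; fin_cases i <;> simp [vecNum, numVec]

theorem continuous_vecNum : Continuous vecNum := by
  have : vecNum = fun v => (v 0 : ℂ) + (v 1 : ℂ) * Complex.I := by
    funext v; apply Complex.ext <;> simp [vecNum]
  rw [this]
  fun_prop

theorem continuous_numVec : Continuous numVec := by
  refine continuous_pi fun i => ?_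
  fin_cases i
  · exact Complex.continuous_re
  · exact Complex.continuous_im

theorem vecNum_add (v w : Fin 2 → ℝ) : vecNum (v + w) = vecNum v + vecNum w := by
  apply Complex.ext <;> simp [vecNum]

theorem vecNum_rot_mulVec (t : ℝ) (v : Fin 2 → ℝ) :
    vecNum ((rot t).val *ᵥ v) = unitExp t * vecNum v := by
  apply Complex.ext <;> simp [vecNum, rot, rotMatrix, unitExp, Matrix.mulVec, dotProduct,
    Fin.sum_univ_two]
  all_goals ring

variable {Λ : Subgroup (GL (Fin 2) ℝ)}

/-- The rotation part of an element of `Λ ⋉ ℝ²`, as a complex number. -/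
def rotPart (g : PlaneSemi Λ) : ℂ := rotNum (SemidirectProduct.right g : Λ)

/-- The translation part of an element of `Λ ⋉ ℝ²`, as a complex number. -/
def transPart (g : PlaneSemi Λ) : ℂ := vecNum (Multiplicative.toAdd (SemidirectProduct.left g))

/-- The element of `Λ ⋉ ℝ²` with given rotation and translation parts. -/
def semiMk (A : Λ) (w : ℂ) : PlaneSemi Λ := ⟨Multiplicative.ofAdd (numVec w), A⟩

theorem rotPart_semiMk (A : Λ) (w : ℂ) : rotPart (semiMk A w) = rotNum A := rfl

theorem transPart_semiMk (A : Λ) (w : ℂ) : transPart (semiMk A w) = w := vecNum_numVec w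

theorem IsRotationGroup.rotNum_mul (hΛ : IsRotationGroup Λ) (A B : Λ) :
    rotNum ((A * B : Λ) : GL (Fin 2) ℝ) = rotNum A * rotNum B := by
  obtain ⟨s, hs⟩ := hΛ A A.2
  obtain ⟨t, ht⟩ := hΛ B B.2
  rw [Subgroup.coe_mul, hs, ht, ← rot_add, rotNum_rot, rotNum_rot, rotNum_rot, unitExp_add]

theorem IsRotationGroup.rotNum_injective (hΛ : IsRotationGroup Λ) {A B : Λ}
    (h : rotNum A = rotNum B) : A = B := by
  obtain ⟨s, hs⟩ := hΛ A A.2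
  obtain ⟨t, ht⟩ := hΛ B B.2
  rw [hs, ht, rotNum_rot, rotNum_rot] at h
  exact Subtype.ext (by rw [hs, ht, rot_eq_of_unitExp_eq h])

theorem IsRotationGroup.rotPart_mul (hΛ : IsRotationGroup Λ) (g h : PlaneSemi Λ) :
    rotPart (g * h) = rotPart g * rotPart h := hΛ.rotNum_mul _ _

theorem IsRotationGroup.transPart_mul (hΛ : IsRotationGroup Λ) (g h : PlaneSemi Λ) :
    transPart (g * h) = transPart g + rotPart g * transPart h := by
  obtain ⟨s, hs⟩ := hΛ _ (SemidirectProduct.right g : Λ).2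
  have : transPart (g * h) = vecNum (Multiplicative.toAdd (SemidirectProduct.left g) +
      (SemidirectProduct.right g : Λ).1.val *ᵥ Multiplicative.toAdd (SemidirectProduct.left h)) :=
    rfl
  rw [this, vecNum_add, rotPart, hs, vecNum_rot_mulVec, rotNum_rot]
  rfl

theorem IsRotationGroup.norm_rotPart (hΛ : IsRotationGroup Λ) (g : PlaneSemi Λ) :
    ‖rotPart g‖ = 1 := by
  obtain ⟨s, hs⟩ := hΛ _ (SemidirectProduct.right g : Λ).2
  rw [rotPart, hs, rotNum_rot, norm_unitExp]

theorem IsRotationGroup.rotPart_ne_zero (hΛ : IsRotationGroup Λ) (g : PlaneSemi Λ) :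
    rotPart g ≠ 0 := by
  rw [← norm_ne_zero_iff, hΛ.norm_rotPart]; exact one_ne_zero

theorem rotPart_one : rotPart (1 : PlaneSemi Λ) = 1 := by
  have : rotPart (1 : PlaneSemi Λ) = rotNum 1 := rfl
  rw [this, ← rot_zero, rotNum_rot, unitExp_zero]

theorem IsRotationGroup.rotPart_inv (hΛ : IsRotationGroup Λ) (g : PlaneSemi Λ) :
    rotPart g⁻¹ = (rotPart g)⁻¹ := by
  refine eq_inv_of_mul_eq_one_left ?_
  rw [← hΛ.rotPart_mul, inv_mul_cancel, rotPart_one]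

theorem transPart_one : transPart (1 : PlaneSemi Λ) = 0 := by
  have : transPart (1 : PlaneSemi Λ) = vecNum 0 := rfl
  rw [this]; rfl

theorem IsRotationGroup.transPart_inv (hΛ : IsRotationGroup Λ) (g : PlaneSemi Λ) :
    transPart g⁻¹ = -((rotPart g)⁻¹ * transPart g) := by
  have h := hΛ.transPart_mul g⁻¹ g
  rw [inv_mul_cancel, transPart_one, hΛ.rotPart_inv] at h
  exact eq_neg_of_add_eq_zero_left h.symm

theorem IsRotationGroup.ext (hΛ : IsRotationGroup Λ) {g h : PlaneSemi Λ}
    (h1 : rotPart g = rotPart h) (h2 : transPart g = transPart h) : g = h := by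
  refine SemidirectProduct.ext ?_ (hΛ.rotNum_injective h1)
  have := congrArg numVec h2
  simp only [transPart, numVec_vecNum] at this
  exact this

theorem isInducing_planeSemi : @IsInducing (PlaneSemi Λ) (Λ × Multiplicative (Fin 2 → ℝ)) _
    (@instTopologicalSpaceProd Λ (Multiplicative (Fin 2 → ℝ)) ⊥ inferInstance)
    fun x : PlaneSemi Λ => (SemidirectProduct.right x, SemidirectProduct.left x) :=
  @IsInducing.mk _ _ _ (@instTopologicalSpaceProd Λ (Multiplicative (Fin 2 → ℝ)) ⊥ inferInstance)
    _ rfl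

theorem continuous_right : @Continuous (PlaneSemi Λ) Λ _ ⊥
    fun x : PlaneSemi Λ => (SemidirectProduct.right x : Λ) := by
  let : TopologicalSpace Λ := ⊥
  exact continuous_fst.comp (isInducing_planeSemi (Λ := Λ)).continuous

theorem continuous_rotPart : Continuous (rotPart : PlaneSemi Λ → ℂ) := by
  let : TopologicalSpace Λ := ⊥
  have : DiscreteTopology Λ := ⟨rfl⟩
  have h : Continuous fun A : Λ => rotNum A := continuous_of_discreteTopology
  exact h.comp continuous_right

theorem continuous_transPart : Continuous (transPart : PlaneSemi Λ → ℂ) := by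
  let : TopologicalSpace Λ := ⊥
  exact continuous_vecNum.comp (continuous_toAdd.comp
    (continuous_snd.comp (isInducing_planeSemi (Λ := Λ)).continuous))

theorem secondCountableTopology_planeSemi [Countable Λ] :
    SecondCountableTopology (PlaneSemi Λ) := by
  let : TopologicalSpace Λ := ⊥
  have : DiscreteTopology Λ := ⟨rfl⟩
  have : SecondCountableTopology (Multiplicative (Fin 2 → ℝ)) :=
    inferInstanceAs (SecondCountableTopology (Fin 2 → ℝ))
  exact (isInducing_planeSemi (Λ := Λ)).secondCountableTopology

/-- A sequence converges in `Λ ⋉ ℝ²` iff its rotation parts are eventually constant and its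
translation parts converge. -/
theorem IsRotationGroup.exists_tendsto_iff (hΛ : IsRotationGroup Λ) (u : ℕ → PlaneSemi Λ) :
    (∃ g, Tendsto u atTop (𝓝 g)) ↔
      (∃ ζ, ∀ᶠ n in atTop, rotPart (u n) = ζ) ∧
        ∃ w, Tendsto (fun n => transPart (u n)) atTop (𝓝 w) := by
  let : TopologicalSpace Λ := ⊥
  have : DiscreteTopology Λ := ⟨rfl⟩
  constructor
  · rintro ⟨g, hg⟩
    refine ⟨⟨rotPart g, ?_⟩, transPart g, (continuous_transPart.tendsto g).comp hg⟩
    have h1 := ((continuous_right (Λ := Λ)).tendsto g).comp hg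
    rw [nhds_discrete, tendsto_pure] at h1
    filter_upwards [h1] with n hn
    exact congrArg (fun A : Λ => rotNum A) hn
  · rintro ⟨⟨ζ, hζ⟩, w, hw⟩
    obtain ⟨N, hN⟩ := hζ.exists
    refine ⟨semiMk (SemidirectProduct.right (u N)) w,
      (isInducing_planeSemi (Λ := Λ)).tendsto_nhds_iff.2 (Tendsto.prodMk_nhds ?_ ?_)⟩
    · refine tendsto_const_nhds.congr' ?_
      filter_upwards [hζ] with n hn
      exact hΛ.rotNum_injective (hN.trans hn.symm)
    · have h1 := (continuous_ofAdd.tendsto (numVec w)).comp ((continuous_numVec.tendsto w).comp hw)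
      refine h1.congr fun n => ?_
      simp [transPart, numVec_vecNum]

theorem IsRotationGroup.rotPart_div (hΛ : IsRotationGroup Λ) (g h : PlaneSemi Λ) :
    rotPart (g * h⁻¹) = rotPart g * (rotPart h)⁻¹ := by
  rw [hΛ.rotPart_mul, hΛ.rotPart_inv]

theorem IsRotationGroup.transPart_div (hΛ : IsRotationGroup Λ) (g h : PlaneSemi Λ) :
    transPart (g * h⁻¹) = transPart g - rotPart g * (rotPart h)⁻¹ * transPart h := by
  rw [hΛ.transPart_mul, hΛ.transPart_inv]
  ring

/-- `E(Λ ⋉ ℝ²)` in complex coordinates. -/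
theorem IsRotationGroup.inducedEquiv_iff (hΛ : IsRotationGroup Λ) (x y : ℕ → PlaneSemi Λ) :
    inducedEquiv (PlaneSemi Λ) x y ↔ ∃ ζ : ℂ,
      (∀ᶠ n in atTop, rotPart (x n) = ζ * rotPart (y n)) ∧
        ∃ w, Tendsto (fun n => transPart (x n) - ζ * transPart (y n)) atTop (𝓝 w) := by
  have h0 : inducedEquiv (PlaneSemi Λ) x y ↔
    ∃ g, Tendsto (fun n => x n * (y n)⁻¹) atTop (𝓝 g) := Iff.rfl
  have h1 : ∀ n ζ, rotPart (x n) * (rotPart (y n))⁻¹ = ζ ↔ rotPart (x n) = ζ * rotPart (y n) :=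
    fun n ζ => ⟨fun h => by rw [← h, inv_mul_cancel_right₀ (hΛ.rotPart_ne_zero _)],
      fun h => by rw [h, mul_inv_cancel_right₀ (hΛ.rotPart_ne_zero _)]⟩
  rw [h0, hΛ.exists_tendsto_iff]
  simp only [hΛ.rotPart_div, hΛ.transPart_div]
  constructor
  · rintro ⟨⟨ζ, hζ⟩, w, hw⟩
    refine ⟨ζ, by simpa only [h1] using hζ, w, hw.congr' ?_⟩
    filter_upwards [hζ] with n hn
    rw [hn]
  · rintro ⟨ζ, hζ, w, hw⟩
    have hζ' : ∀ᶠ n in atTop, rotPart (x n) * (rotPart (y n))⁻¹ = ζ := by simpa only [h1] using hζ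
    refine ⟨⟨ζ, hζ'⟩, w, hw.congr' ?_⟩
    filter_upwards [hζ'] with n hn
    rw [hn]

instance finite_gammaFin (k : ℕ) : Finite (GammaFin k) := by
  have : (GammaFin k : Set (GL (Fin 2) ℝ)) ⊆ (fun i : ℕ => rot (i / k)) '' Set.Iic k := by
    rintro _ ⟨i, hi, rfl⟩
    exact ⟨i, hi, rfl⟩
  exact ((Set.finite_Iic k).image _).subset this

theorem rotNum_gammaFin_pow {k : ℕ} (hk : k ≠ 0) (A : GammaFin k) : rotNum A ^ k = 1 := by
  obtain ⟨i, -, hi⟩ := A.2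
  rw [hi, rotNum_rot, ← unitExp_natCast_mul, unitExp_eq_one_iff]
  exact ⟨i, by field_simp; simp⟩

end

section

variable {Λ : Subgroup (GL (Fin 2) ℝ)}

/-- Irrationality of √2: `GammaZ` is torsion free. -/
theorem unitExp_sqrt_two_mul_eq_one {k : ℕ} (hk : k ≠ 0) {n : ℤ}
    (h : unitExp (√2 * n) ^ k = 1) : n = 0 := by
  rw [← unitExp_natCast_mul, unitExp_eq_one_iff] at h
  obtain ⟨m, hm⟩ := h
  by_contra hn
  have h1 : Irrational (((k * n : ℤ) : ℝ) * √2) :=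
    irrational_sqrt_two.intCast_mul (mul_ne_zero (by exact_mod_cast hk) hn)
  refine h1 ⟨m, ?_⟩
  push_cast
  rw [← hm]
  ring

/-! ### The identity component and conjugations -/

theorem continuous_semiMk (A : Λ) : Continuous (semiMk A) := by
  let : TopologicalSpace Λ := ⊥
  exact (isInducing_planeSemi (Λ := Λ)).continuous_iff.2
    (continuous_const.prodMk (continuous_ofAdd.comp continuous_numVec))

theorem semiMk_one_zero : semiMk (1 : Λ) 0 = 1 := by
  refine SemidirectProduct.ext ?_ rfl
  have : numVec 0 = 0 := by ext i; fin_cases i <;> simp [numVec]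
  exact congrArg Multiplicative.ofAdd this

theorem semiMk_one_mem_connectedComponent (w : ℂ) :
    semiMk (1 : Λ) w ∈ Subgroup.connectedComponentOfOne (PlaneSemi Λ) := by
  have h : IsPreconnected (Set.range (semiMk (1 : Λ))) :=
    isPreconnected_range (continuous_semiMk 1)
  exact h.subset_connectedComponent ⟨0, semiMk_one_zero⟩ ⟨w, rfl⟩

theorem rotPart_of_mem_connectedComponent {g : PlaneSemi Λ}
    (hg : g ∈ Subgroup.connectedComponentOfOne (PlaneSemi Λ)) : rotPart g = 1 := by
  let : TopologicalSpace Λ := ⊥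
  have : DiscreteTopology Λ := ⟨rfl⟩
  have h1 : (SemidirectProduct.right g : Λ) = SemidirectProduct.right (1 : PlaneSemi Λ) :=
    (isPreconnected_connectedComponent (x := (1 : PlaneSemi Λ))).constant
      (continuous_right (Λ := Λ)).continuousOn hg mem_connectedComponent
  rw [← rotPart_one (Λ := Λ)]
  exact congrArg (fun A : Λ => rotNum A) h1

theorem IsRotationGroup.transPart_conjAut (hΛ : IsRotationGroup Λ) (u : PlaneSemi Λ)
    (g : Subgroup.connectedComponentOfOne (PlaneSemi Λ)) :
    transPart (conjAut _ u g : PlaneSemi Λ) = rotPart u * transPart (g : PlaneSemi Λ) := by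
  have h : (conjAut _ u g : PlaneSemi Λ) = u * g * u⁻¹ := rfl
  have := hΛ.rotPart_ne_zero u
  rw [h, hΛ.transPart_div, hΛ.transPart_mul, hΛ.rotPart_mul,
    rotPart_of_mem_connectedComponent g.2]
  field_simp
  ring

theorem IsRotationGroup.transPart_conjAut_iterate (hΛ : IsRotationGroup Λ) (u : PlaneSemi Λ)
    (g : Subgroup.connectedComponentOfOne (PlaneSemi Λ)) (n : ℕ) :
    transPart ((conjAut _ u)^[n] g : PlaneSemi Λ) =
      rotPart u ^ n * transPart (g : PlaneSemi Λ) := by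
  induction n with
  | zero => simp
  | succ n ih => rw [Function.iterate_succ_apply', hΛ.transPart_conjAut, ih, pow_succ']; ring

theorem IsRotationGroup.ext_connectedComponent (hΛ : IsRotationGroup Λ)
    {g h : Subgroup.connectedComponentOfOne (PlaneSemi Λ)}
    (hgh : transPart (g : PlaneSemi Λ) = transPart (h : PlaneSemi Λ)) : g = h :=
  Subtype.ext (hΛ.ext ((rotPart_of_mem_connectedComponent g.2).trans
    (rotPart_of_mem_connectedComponent h.2).symm) hgh)

/-- Let u rotate by 1/k and let v induce the automorphism corresponding to u. Since u acts with k-th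
power trivial, so does v, and torsion-freeness forces v to act trivially. Then u acts trivially as
well, which fails for k ≥ 2. -/
theorem not_exists_isomorphism {k : ℕ} (hk : 2 ≤ k) :
    ¬ ∃ φ : Subgroup.connectedComponentOfOne (PlaneSemi (GammaFin k)) ≃ₜ*
            Subgroup.connectedComponentOfOne (PlaneSemi GammaZ),
          (fun ι => (φ.symm.trans ι).trans φ) ''
              Inn (Subgroup.connectedComponentOfOne (PlaneSemi (GammaFin k))) ⊆
            Inn (Subgroup.connectedComponentOfOne (PlaneSemi GammaZ)) := by
  rintro ⟨φ, hφ⟩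
  have hk0 : (k : ℝ) ≠ 0 := by positivity
  have hG := isRotationGroup_gammaFin k
  let u : PlaneSemi (GammaFin k) := semiMk ⟨rot ((1 : ℕ) / k), 1, by omega, rfl⟩ 0
  have hu : rotPart u = unitExp (1 / k) := by simp [u, rotPart_semiMk, rotNum_rot]
  obtain ⟨v, hv⟩ := hφ ⟨_, ⟨u, rfl⟩, rfl⟩
  have hv1 : ∀ g, φ (conjAut _ u g) = conjAut _ v (φ g) := by
    intro g
    rw [hv]
    simp
  have hvn : ∀ n g, φ ((conjAut (Subgroup.connectedComponentOfOne (PlaneSemi (GammaFin k))) u)^[n] g) =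
      (conjAut (Subgroup.connectedComponentOfOne (PlaneSemi GammaZ)) v)^[n] (φ g) := by
    intro n g
    induction n with
    | zero => rfl
    | succ n ih => rw [Function.iterate_succ_apply', Function.iterate_succ_apply', hv1, ih]
  have huk : ∀ g, (conjAut (Subgroup.connectedComponentOfOne (PlaneSemi (GammaFin k))) u)^[k] g = g := by
    intro g
    refine hG.ext_connectedComponent ?_
    rw [hG.transPart_conjAut_iterate, rotPart, rotNum_gammaFin_pow (by omega), one_mul]
  have hvk : rotPart v ^ k = 1 := by
    let t : Subgroup.connectedComponentOfOne (PlaneSemi GammaZ) :=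
      ⟨semiMk 1 1, semiMk_one_mem_connectedComponent 1⟩
    have h1 := hvn k (φ.symm t)
    rw [huk, ContinuousMulEquiv.apply_symm_apply] at h1
    have h2 := isRotationGroup_gammaZ.transPart_conjAut_iterate v t k
    rw [← h1] at h2
    have h3 : transPart (t : PlaneSemi GammaZ) = 1 := transPart_semiMk _ _
    rw [h3, mul_one] at h2
    exact h2.symm
  obtain ⟨n, hn⟩ := (SemidirectProduct.right v : GammaZ).2
  have hv' : rotPart v = unitExp (√2 * n) := by rw [rotPart, hn, rotNum_rot]
  have hn0 : n = 0 := unitExp_sqrt_two_mul_eq_one (k := k) (by omega) (by rw [← hv', hvk])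
  have hv0 : rotPart v = 1 := by rw [hv', hn0]; simp [unitExp_zero]
  have hvid : ∀ g, conjAut _ v g = g := fun g =>
    isRotationGroup_gammaZ.ext_connectedComponent
      (by rw [isRotationGroup_gammaZ.transPart_conjAut, hv0, one_mul])
  let t : Subgroup.connectedComponentOfOne (PlaneSemi (GammaFin k)) :=
    ⟨semiMk 1 1, semiMk_one_mem_connectedComponent 1⟩
  have h1 := hv1 t
  rw [hvid] at h1
  have h2 := hG.transPart_conjAut u t
  have h3 : transPart (t : PlaneSemi (GammaFin k)) = 1 := transPart_semiMk _ _
  rw [φ.injective h1, h3, mul_one, hu] at h2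
  obtain ⟨m, hm⟩ := (unitExp_eq_one_iff _).1 h2.symm
  have h4 : (m : ℝ) * k = 1 := by rw [← hm]; field_simp
  have h5 : m * k = 1 := by exact_mod_cast h4
  have h6 : (k : ℤ) ∣ 1 := ⟨m, by linarith⟩
  have := Int.le_of_dvd one_pos h6
  omega

/-! ### The reduction of `E(Γ_k ⋉ ℝ²)` to `E(Γ^z ⋉ ℝ²)` -/

/-- Density of ℤ√2 + ℤ in ℝ; the integer summand is invisible to `unitExp`. -/
theorem exists_sqrt_two_approx (A : GL (Fin 2) ℝ) (hA : ∃ t, A = rot t) {ε : ℝ} (hε : 0 < ε) :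
    ∃ (m : ℤ) (e : ℝ), |e| ≤ ε ∧ unitExp (√2 * m) = unitExp e * rotNum A := by
  obtain ⟨t, rfl⟩ := hA
  have hd : Dense (AddSubgroup.closure {√2, 1} : Set ℝ) :=
    dense_addSubgroupClosure_pair_iff.2 (by simpa using irrational_sqrt_two)
  obtain ⟨s, hs, hst⟩ := hd.exists_dist_lt t hε
  obtain ⟨m, l, hml⟩ := AddSubgroup.mem_closure_pair.1 hs
  refine ⟨m, s - t, ?_, ?_⟩
  · rw [dist_comm, Real.dist_eq] at hst
    exact hst.le
  · rw [rotNum_rot, ← unitExp_add, sub_add_cancel, ← hml, unitExp_add]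
    have : unitExp (l • (1 : ℝ)) = 1 := (unitExp_eq_one_iff _).2 ⟨l, by simp⟩
    rw [this, mul_one, zsmul_eq_mul, mul_comm]

theorem eventually_eq_of_tendsto_of_finite {u : ℕ → ℂ} {a : ℂ} {S : Set ℂ} (hS : S.Finite)
    (hu : ∀ᶠ n in atTop, u n ∈ S) (h : Tendsto u atTop (𝓝 a)) : ∀ᶠ n in atTop, u n = a := by
  have hc : (S \ {a})ᶜ ∈ 𝓝 a := (hS.subset Set.sdiff_subset).isClosed.isOpen_compl.mem_nhds (by simp)
  filter_upwards [hu, h hc] with n h1 h2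
  by_contra hne
  exact h2 ⟨h1, hne⟩

theorem finite_pow_eq_one {k : ℕ} (hk : k ≠ 0) : {z : ℂ | z ^ k = 1}.Finite := by
  refine (Polynomial.nthRootsFinset k (1 : ℂ)).finite_toSet.subset fun z hz => ?_
  exact (Polynomial.mem_nthRootsFinset (Nat.pos_of_ne_zero hk) _).2 hz

theorem exists_tendsto_partial_sum {e : ℕ → ℝ} (he : ∀ n, |e n| ≤ (1 / 2) ^ n) :
    ∃ a, Tendsto (fun n => ∑ j ∈ Finset.range (n + 1), e j) atTop (𝓝 a) := by
  have hs : Summable e := Summable.of_norm_bounded summable_geometric_two he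
  exact ⟨_, hs.hasSum.tendsto_sum_nat.comp (tendsto_add_atTop_nat 1)⟩

/-- The reduction multiplies both complex coordinates of `x n` by the unimodular factor `F x n`,
chosen to move the rotation part into `GammaZ` and to converge as `n` grows. -/
theorem borelReducible_gammaFin_gammaZ {k : ℕ} (hk : k ≠ 0) :
    BorelReducible (inducedEquiv (PlaneSemi (GammaFin k))) (inducedEquiv (PlaneSemi GammaZ)) := by
  have hG := isRotationGroup_gammaFin k
  have hH := isRotationGroup_gammaZ
  have happ : ∀ (j : ℕ) (A : GammaFin k), ∃ (m : ℤ) (e : ℝ), |e| ≤ (1 / 2) ^ j ∧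
      unitExp (√2 * m) = unitExp e * rotNum A := fun j A =>
    exists_sqrt_two_approx A (hG A A.2) (by positivity)
  choose m e he hme using happ
  let R : (ℕ → PlaneSemi (GammaFin k)) → ℕ → GammaFin k := fun x n => SemidirectProduct.right (x n)
  -- Increments are approximated, not the rotations themselves: equivalent sequences eventually have
  -- the same increments, hence the same integers `m`, so that `M x n - M y n` stabilises. The
  -- bounds on `e` are summable, so `F` converges.
  let D : (ℕ → PlaneSemi (GammaFin k)) → ℕ → GammaFin k := fun x n =>
    Nat.casesOn n (R x 0) fun n => R x (n + 1) * (R x n)⁻¹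
  let M : (ℕ → PlaneSemi (GammaFin k)) → ℕ → ℤ := fun x n =>
    ∑ j ∈ Finset.range (n + 1), m j (D x j)
  let F : (ℕ → PlaneSemi (GammaFin k)) → ℕ → ℂ := fun x n =>
    unitExp (∑ j ∈ Finset.range (n + 1), e j (D x j))
  have hMF : ∀ x n, unitExp (√2 * M x n) = F x n * rotPart (x n) := by
    intro x n
    induction n with
    | zero => simp [M, F, D, R, hme, rotPart]
    | succ n ih =>
      have h1 : M x (n + 1) = M x n + m (n + 1) (D x (n + 1)) := Finset.sum_range_succ _ _
      have h2 : F x (n + 1) = F x n * unitExp (e (n + 1) (D x (n + 1))) := by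
        simp only [F]
        rw [Finset.sum_range_succ _ (n + 1), unitExp_add]
      have h3 : rotPart (x (n + 1)) = rotNum (D x (n + 1)) * rotPart (x n) := by
        have h4 : D x (n + 1) * R x n = R x (n + 1) := inv_mul_cancel_right _ _
        have h5 := hG.rotNum_mul (D x (n + 1)) (R x n)
        rw [h4] at h5
        exact h5
      rw [h1, h2, h3]
      push_cast
      rw [mul_add, unitExp_add, ih, hme]
      ring
  have hF : ∀ x, ∃ a, a ≠ 0 ∧ Tendsto (F x) atTop (𝓝 a) := by
    intro x
    obtain ⟨a, ha⟩ := exists_tendsto_partial_sum fun n => he n (D x n)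
    exact ⟨unitExp a, unitExp_ne_zero a, (continuous_unitExp.tendsto a).comp ha⟩
  have hF0 : ∀ x n, F x n ≠ 0 := fun x n => unitExp_ne_zero _
  let θ : (ℕ → PlaneSemi (GammaFin k)) → ℕ → PlaneSemi GammaZ := fun x n =>
    semiMk ⟨rot (√2 * M x n), M x n, rfl⟩ (F x n * transPart (x n))
  have hθr : ∀ x n, rotPart (θ x n) = F x n * rotPart (x n) := fun x n => hMF x n
  have hθt : ∀ x n, transPart (θ x n) = F x n * transPart (x n) := fun x n => transPart_semiMk _ _
  refine ⟨θ, ?_, fun x y => ?_⟩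
  · have hcont : Continuous θ := by
      let : TopologicalSpace (GammaFin k) := ⊥
      have : DiscreteTopology (GammaFin k) := ⟨rfl⟩
      let : TopologicalSpace GammaZ := ⊥
      have hR : ∀ n, Continuous fun x => R x n := fun n =>
        (continuous_right (Λ := GammaFin k)).comp (continuous_apply n)
      have hD : ∀ n, Continuous fun x => D x n := by
        rintro (_ | n)
        · exact hR 0
        · have h : Continuous fun p : GammaFin k × GammaFin k => p.1 * p.2⁻¹ :=
            continuous_of_discreteTopology
          exact h.comp ((hR (n + 1)).prodMk (hR n))
      have hM : ∀ n, Continuous fun x => M x n := fun n =>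
        continuous_finsetSum _ fun j _ =>
          (continuous_of_discreteTopology (f := m j)).comp (hD j)
      have hFc : ∀ n, Continuous fun x => F x n := fun n =>
        continuous_unitExp.comp (continuous_finsetSum _ fun j _ =>
          (continuous_of_discreteTopology (f := e j)).comp (hD j))
      refine continuous_pi fun n => (isInducing_planeSemi (Λ := GammaZ)).continuous_iff.2
        (Continuous.prodMk ?_ ?_)
      · have h : Continuous fun i : ℤ => (⟨rot (√2 * i), i, rfl⟩ : GammaZ) :=
          continuous_of_discreteTopology
        exact h.comp (hM n)
      · exact continuous_ofAdd.comp (continuous_numVec.comp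
          ((hFc n).mul (continuous_transPart.comp (continuous_apply n))))
    borelize (ℕ → PlaneSemi (GammaFin k))
    borelize (ℕ → PlaneSemi GammaZ)
    exact hcont.measurable
  rw [hG.inducedEquiv_iff, hH.inducedEquiv_iff]
  simp only [hθr, hθt]
  constructor
  · rintro ⟨z, hz, w, hw⟩
    obtain ⟨N, hN⟩ := eventually_atTop.1 hz
    -- The constant factor `z` cancels in successive quotients, since rotations commute.
    have hD : ∀ n ≥ N, D x (n + 1) = D y (n + 1) := by
      intro n hn
      refine hG.rotNum_injective ?_
      have h4 : ∀ x, rotNum (D x (n + 1)) * rotPart (x n) = rotPart (x (n + 1)) := by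
        intro x
        have h4 : D x (n + 1) * R x n = R x (n + 1) := inv_mul_cancel_right _ _
        have h5 := hG.rotNum_mul (D x (n + 1)) (R x n)
        rw [h4] at h5
        exact h5.symm
      have hx := h4 x
      rw [hN n hn, hN (n + 1) (by omega), ← h4 y] at hx
      have h0 : z * rotPart (y n) ≠ 0 := by rw [← hN n hn]; exact hG.rotPart_ne_zero _
      refine mul_right_cancel₀ h0 ?_
      rw [hx]; ring
    have hM : ∀ n ≥ N, M x n - M y n = M x N - M y N := by
      intro n hn
      induction n, hn using Nat.le_induction with
      | base => rfl
      | succ n hn ih =>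
        have h1 : ∀ x, M x (n + 1) = M x n + m (n + 1) (D x (n + 1)) :=
          fun x => Finset.sum_range_succ _ _
        rw [h1, h1, hD n hn, ← ih]
        ring
    set z' := unitExp (√2 * (M x N - M y N : ℤ)) with hz'
    have hZ : ∀ n ≥ N, F x n * rotPart (x n) = z' * (F y n * rotPart (y n)) := by
      intro n hn
      rw [← hMF, ← hMF, hz', ← unitExp_add, ← hM n hn]
      push_cast
      ring_nf
    have hFz : ∀ n ≥ N, F x n * z = z' * F y n := by
      intro n hn
      have := hZ n hn
      rw [hN n hn] at this
      refine mul_right_cancel₀ (hG.rotPart_ne_zero (y n)) ?_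
      linear_combination this
    refine ⟨z', eventually_atTop.2 ⟨N, hZ⟩, ?_⟩
    obtain ⟨a, -, ha⟩ := hF x
    refine ⟨a * w, (ha.mul hw).congr' ?_⟩
    filter_upwards [eventually_ge_atTop N] with n hn
    linear_combination (-transPart (y n)) * hFz n hn
  · rintro ⟨z', hz', w, hw⟩
    obtain ⟨a, ha0, ha⟩ := hF x
    obtain ⟨b, -, hb⟩ := hF y
    have hconv : Tendsto (fun n => (F x n)⁻¹ * z' * F y n) atTop (𝓝 (a⁻¹ * z' * b)) :=
      ((ha.inv₀ ha0).mul_const z').mul hb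
    have hrat : ∀ᶠ n in atTop, (F x n)⁻¹ * z' * F y n = rotPart (x n) * (rotPart (y n))⁻¹ := by
      filter_upwards [hz'] with n hn
      have := hF0 x n
      have := hG.rotPart_ne_zero (y n)
      field_simp
      linear_combination -hn
    -- This is where finiteness of `GammaFin k` enters: the quotient of the rotation parts converges
    -- and consists of k-th roots of unity.
    have hconst := eventually_eq_of_tendsto_of_finite (finite_pow_eq_one hk) (by
      filter_upwards [hrat] with n hn
      rw [hn, mul_pow, inv_pow, rotPart, rotPart, rotNum_gammaFin_pow hk,
        rotNum_gammaFin_pow hk, inv_one, mul_one]) hconv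
    refine ⟨a⁻¹ * z' * b, ?_, a⁻¹ * w, ((ha.inv₀ ha0).mul hw).congr' ?_⟩
    · filter_upwards [hrat, hconst] with n h1 h2
      rw [← h2, h1, inv_mul_cancel_right₀ (hG.rotPart_ne_zero _)]
    · filter_upwards [hconst] with n h2
      have := hF0 x n
      rw [← h2]
      field_simp

end

section

/-! ### Piecewise control of sequences -/

/-- A sequence whose oscillation over the consecutive intervals `[b n, b (n + 1)]` is eventually
dominated by a geometric sequence converges. -/
theorem exists_tendsto_of_geometric_oscillation {γ : ℕ → ℂ} {b : ℕ → ℕ} (hb : StrictMono b) {C : ℝ}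
    {N : ℕ} (h : ∀ n ≥ N, ∀ m, b n ≤ m → m ≤ b (n + 1) → ‖γ m - γ (b n)‖ ≤ C * (1 / 2) ^ n) :
    ∃ a, Tendsto γ atTop (𝓝 a) := by
  have hc : CauchySeq fun n => γ (b (n + N)) := by
    refine cauchySeq_of_le_geometric (1 / 2) (C * (1 / 2) ^ N) (by norm_num) fun n => ?_
    rw [dist_comm, dist_eq_norm]
    have := h (n + N) (by omega) (b (n + N + 1)) (hb.monotone (by omega)) le_rfl
    rw [show n + 1 + N = n + N + 1 by ring]
    refine this.trans_eq ?_
    rw [pow_add]; ring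
  obtain ⟨a, ha⟩ := cauchySeq_tendsto_of_complete hc
  refine ⟨a, ?_⟩
  rw [tendsto_add_atTop_iff_nat (f := fun n => γ (b n)) N] at ha
  have h2 : Tendsto (fun n => C * (1 / 2 : ℝ) ^ n + ‖γ (b n) - a‖) atTop (𝓝 0) := by
    have h3 := (tendsto_pow_atTop_nhds_zero_of_lt_one (r := (1 / 2 : ℝ)) (by norm_num)
      (by norm_num)).const_mul C
    simpa using h3.add (tendsto_iff_norm_sub_tendsto_zero.1 ha)
  rw [Metric.tendsto_atTop]
  intro ε hε
  obtain ⟨M, hM⟩ := eventually_atTop.1 (h2.eventually_lt_const hε)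
  refine ⟨b (N + M), fun m hm => ?_⟩
  have hex : ∃ n, m < b (n + 1) := ⟨m, hb.le_apply⟩
  obtain ⟨h4, h5⟩ := (Nat.find_eq_iff hex).1 rfl
  set n := Nat.find hex
  have hn : N + M ≤ n := Nat.lt_succ_iff.1 (hb.lt_iff_lt.1 (hm.trans_lt h4))
  have h6 : b n ≤ m := by
    rcases Nat.eq_zero_or_pos n with h0 | h0
    · rw [h0]; exact (hb.monotone (Nat.zero_le _)).trans hm
    · have := h5 (n - 1) (by omega)
      rw [Nat.sub_add_cancel h0] at this
      omega
  rw [dist_eq_norm]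
  calc ‖γ m - a‖ = ‖(γ m - γ (b n)) + (γ (b n) - a)‖ := by congr 1; ring
    _ ≤ ‖γ m - γ (b n)‖ + ‖γ (b n) - a‖ := norm_add_le _ _
    _ ≤ C * (1 / 2) ^ n + ‖γ (b n) - a‖ := by gcongr; exact h n (by omega) m h6 h4.le
    _ < ε := hM n (by omega)

/-- A sequence that is constant on the consecutive intervals `[b n, b (n + 1)]`, `n ≥ N`, is
eventually constant. -/
theorem eventually_eq_of_piecewise_const {γ : ℕ → ℂ} {b : ℕ → ℕ} (hb : StrictMono b)
    {N : ℕ} (h : ∀ n ≥ N, ∀ m, b n ≤ m → m ≤ b (n + 1) → γ m = γ (b n)) :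
    ∃ a, ∀ᶠ m in atTop, γ m = a := by
  have key : ∀ n ≥ N, ∀ m, b N ≤ m → m ≤ b n → γ m = γ (b N) := by
    intro n hn
    induction n, hn using Nat.le_induction with
    | base => intro m h1 h2; rw [le_antisymm h2 h1]
    | succ n hn ih =>
      intro m h1 h2
      rcases le_total m (b n) with h3 | h3
      · exact ih m h1 h3
      · rw [h n hn m h3 h2]
        exact ih _ (hb.monotone hn) le_rfl
  refine ⟨γ (b N), eventually_atTop.2 ⟨b N, fun m hm => key (max N m) (le_max_left _ _) m hm ?_⟩⟩
  exact (le_max_right N m).trans hb.le_apply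

variable {Λ : Subgroup (GL (Fin 2) ℝ)}

/-- On the index set `I` the quotient `X m * (Y m)⁻¹` has rotation part `ζ`, and its translation
part oscillates by at most `ε`. -/
structure NearConst (I : Set ℕ) (ζ : ℂ) (ε : ℝ) (X Y : ℕ → PlaneSemi Λ) : Prop where
  norm_eq : ‖ζ‖ = 1
  rot : ∀ m ∈ I, rotPart (X m) = ζ * rotPart (Y m)
  trans : ∀ m ∈ I, ∀ m' ∈ I, ‖(transPart (X m) - ζ * transPart (Y m)) -
    (transPart (X m') - ζ * transPart (Y m'))‖ ≤ ε

theorem NearConst.mono {I J : Set ℕ} {ζ : ℂ} {ε δ : ℝ} {X Y : ℕ → PlaneSemi Λ}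
    (h : NearConst I ζ ε X Y) (hJ : J ⊆ I) (hδ : ε ≤ δ) : NearConst J ζ δ X Y :=
  ⟨h.norm_eq, fun m hm => h.rot m (hJ hm), fun m hm m' hm' =>
    (h.trans m (hJ hm) m' (hJ hm')).trans hδ⟩

/-- Quotients multiply along X, Y, Z; as `ζ` is unimodular, the second oscillation enters with
weight one. -/
theorem NearConst.comp {I : Set ℕ} {ζ ξ : ℂ} {ε δ : ℝ} {X Y Z : ℕ → PlaneSemi Λ}
    (h : NearConst I ζ ε X Y) (h' : NearConst I ξ δ Y Z) : NearConst I (ζ * ξ) (ε + δ) X Z := by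
  refine ⟨by rw [norm_mul, h.norm_eq, h'.norm_eq, one_mul], fun m hm => ?_, fun m hm m' hm' => ?_⟩
  · rw [h.rot m hm, h'.rot m hm, mul_assoc]
  · have e : (transPart (X m) - ζ * ξ * transPart (Z m)) -
        (transPart (X m') - ζ * ξ * transPart (Z m')) =
        ((transPart (X m) - ζ * transPart (Y m)) - (transPart (X m') - ζ * transPart (Y m'))) +
        ζ * ((transPart (Y m) - ξ * transPart (Z m)) -
          (transPart (Y m') - ξ * transPart (Z m'))) := by ring
    rw [e]
    refine (norm_add_le _ _).trans (add_le_add (h.trans m hm m' hm') ?_)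
    rw [norm_mul, h.norm_eq, one_mul]
    exact h'.trans m hm m' hm'

theorem IsRotationGroup.eq_of_rotPart_eq_mul (hΛ : IsRotationGroup Λ) {a b : ℂ} {g h : PlaneSemi Λ}
    (h1 : rotPart g = a * rotPart h) (h2 : rotPart g = b * rotPart h) : a = b :=
  mul_right_cancel₀ (hΛ.rotPart_ne_zero h) (h1.symm.trans h2)

/-! ### Controlled maps -/

variable {Γ : Type*}

/-- The map `Θ`, restricted to sequences with `x j ∈ K j`, depends in a controlled way on the tails
and the heads of its argument; moreover, rotation parts in `Λ ⋉ ℝ²` at distance at most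
`(1 / 2) ^ i₀` coincide. -/
structure Controlled (K : ℕ → Finset Γ) (l : ℕ → ℕ) (i₀ : ℕ)
    (Θ : (ℕ → Γ) → ℕ → PlaneSemi Λ) : Prop where
  isRotationGroup : IsRotationGroup Λ
  strictMono : StrictMono l
  discrete : ∀ g h : PlaneSemi Λ, ‖rotPart g - rotPart h‖ ≤ (1 / 2) ^ i₀ → rotPart g = rotPart h
  tail : ∀ x y : ℕ → Γ, (∀ j, x j ∈ K j) → (∀ j, y j ∈ K j) → ∀ j, (∀ i ≤ j, x i = y i) →
    ∀ m ≤ l j, ‖rotPart (Θ x m) - rotPart (Θ y m)‖ +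
      ‖transPart (Θ x m) - transPart (Θ y m)‖ ≤ (1 / 2) ^ j
  head : ∀ x y : ℕ → Γ, (∀ j, x j ∈ K j) → (∀ j, y j ∈ K j) → ∀ j, (∀ i, j ≤ i → x i = y i) →
    ∀ m ≥ l (j + 1), ∀ m' ≥ l (j + 1),
      ‖rotPart (Θ x m * (Θ y m)⁻¹) - rotPart (Θ x m' * (Θ y m')⁻¹)‖ +
      ‖transPart (Θ x m * (Θ y m)⁻¹) - transPart (Θ x m' * (Θ y m')⁻¹)‖ ≤ (1 / 2) ^ j

section Controlled

variable {K : ℕ → Finset Γ} {l : ℕ → ℕ} {i₀ : ℕ} {Θ : (ℕ → Γ) → ℕ → PlaneSemi Λ}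

/-- Beyond `i₀` the allowed oscillation is below the gap between rotation parts, so the rotation
part of the quotient is exactly constant, and its translation part takes the linear form used in
`NearConst`. -/
theorem Controlled.nearConst_head (hΘ : Controlled K l i₀ Θ) {x y : ℕ → Γ}
    (hx : ∀ j, x j ∈ K j) (hy : ∀ j, y j ∈ K j) {i : ℕ} (hi : i₀ ≤ i)
    (hxy : ∀ j, i ≤ j → x j = y j) :
    ∃ ζ, NearConst (Set.Ici (l (i + 1))) ζ ((1 / 2) ^ i) (Θ x) (Θ y) := by
  have hΛ := hΘ.isRotationGroup
  set ζ := rotPart (Θ x (l (i + 1)) * (Θ y (l (i + 1)))⁻¹) with hζ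
  have h1 := hΘ.head x y hx hy i hxy
  have hconst : ∀ m ≥ l (i + 1), rotPart (Θ x m * (Θ y m)⁻¹) = ζ := by
    intro m hm
    refine hΘ.discrete _ _ ?_
    have h2 := h1 m hm _ le_rfl
    have h3 : ((1 : ℝ) / 2) ^ i ≤ (1 / 2) ^ i₀ :=
      pow_le_pow_of_le_one (by norm_num) (by norm_num) hi
    have := norm_nonneg (transPart (Θ x m * (Θ y m)⁻¹) -
      transPart (Θ x (l (i + 1)) * (Θ y (l (i + 1)))⁻¹))
    linarith
  have htr : ∀ m ≥ l (i + 1), transPart (Θ x m * (Θ y m)⁻¹) =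
      transPart (Θ x m) - ζ * transPart (Θ y m) := by
    intro m hm
    rw [hΛ.transPart_div, ← hΛ.rotPart_div, hconst m hm]
  refine ⟨ζ, hΛ.norm_rotPart _, fun m hm => ?_, fun m hm m' hm' => ?_⟩
  · rw [← hconst m hm, hΛ.rotPart_div, inv_mul_cancel_right₀ (hΛ.rotPart_ne_zero _)]
  · rw [← htr m hm, ← htr m' hm']
    have h2 := h1 m hm m' hm'
    have := norm_nonneg (rotPart (Θ x m * (Θ y m)⁻¹) - rotPart (Θ x m' * (Θ y m')⁻¹))
    linarith

/-- Locality: where `x` and `y` agree, `Θ x / Θ y` is nearly constant. -/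
theorem Controlled.nearConst_of_agree (hΘ : Controlled K l i₀ Θ) {x y : ℕ → Γ}
    (hx : ∀ j, x j ∈ K j) (hy : ∀ j, y j ∈ K j) {i i' : ℕ} (hi : i₀ ≤ i) (hii : i ≤ i')
    (hxy : ∀ j, i ≤ j → j ≤ i' → x j = y j) :
    ∃ ζ, NearConst (Set.Icc (l (i + 1)) (l i')) ζ (3 * (1 / 2) ^ i) (Θ x) (Θ y) := by
  classical
  -- A hybrid: it agrees with `x` from `i` on (head estimate, cost 1) and with `y` up to `i'` (tail
  -- estimate at two indices, cost 2). This is the factor 3.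
  let w : ℕ → Γ := fun j => if j ≤ i' then y j else x j
  have hw : ∀ j, w j ∈ K j := by
    intro j
    by_cases h : j ≤ i'
    · simpa [w, h] using hy j
    · simpa [w, h] using hx j
  obtain ⟨ζ, h1⟩ := hΘ.nearConst_head hx hw hi fun j hj => by
    by_cases h : j ≤ i'
    · simp [w, h, hxy j hj h]
    · simp [w, h]
  have h2 := hΘ.tail w y hw hy i' fun j hj => by simp [w, hj]
  have h3 : ((1 : ℝ) / 2) ^ i' ≤ (1 / 2) ^ i :=
    pow_le_pow_of_le_one (by norm_num) (by norm_num) hii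
  have h4 : ((1 : ℝ) / 2) ^ i ≤ (1 / 2) ^ i₀ :=
    pow_le_pow_of_le_one (by norm_num) (by norm_num) hi
  have h5 : NearConst (Set.Icc (l (i + 1)) (l i')) 1 ((1 / 2) ^ i + (1 / 2) ^ i) (Θ w) (Θ y) := by
    refine ⟨norm_one, fun m hm => ?_, fun m hm m' hm' => ?_⟩
    · rw [one_mul]
      refine hΘ.discrete _ _ ?_
      have := h2 m hm.2
      have := norm_nonneg (transPart (Θ w m) - transPart (Θ y m))
      linarith
    · rw [one_mul, one_mul]
      refine (norm_sub_le _ _).trans (add_le_add ?_ ?_)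
      · have := h2 m hm.2
        have := norm_nonneg (rotPart (Θ w m) - rotPart (Θ y m))
        linarith
      · have := h2 m' hm'.2
        have := norm_nonneg (rotPart (Θ w m') - rotPart (Θ y m'))
        linarith
  exact ⟨_, ((h1.mono Set.Icc_subset_Ici_self le_rfl).comp h5).mono le_rfl (by linarith)⟩

end Controlled

/-! ### Walks -/

variable [Group Γ]

/-- The sequence that equals `v n` on `[t n, t (n + 1))` and `1` before `t 0`. -/
def walk (v : ℕ → Γ) (t : ℕ → ℕ) (j : ℕ) : Γ :=
  if j < t 0 then 1 else v (Nat.findGreatest (fun n => t n ≤ j) j)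

theorem walk_of_lt {v : ℕ → Γ} {t : ℕ → ℕ} {j : ℕ} (h : j < t 0) : walk v t j = 1 := if_pos h

theorem walk_eq {v : ℕ → Γ} {t : ℕ → ℕ} (ht : StrictMono t) {n j : ℕ} (h1 : t n ≤ j)
    (h2 : j < t (n + 1)) : walk v t j = v n := by
  have h0 : ¬ j < t 0 := not_lt.2 ((ht.monotone (Nat.zero_le n)).trans h1)
  rw [walk, if_neg h0]
  congr 1
  rw [Nat.findGreatest_eq_iff]
  refine ⟨ht.le_apply.trans h1, fun _ => h1, fun m hm _ => ?_⟩
  exact not_le.2 (h2.trans_le (ht.monotone hm))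

theorem exists_index {t : ℕ → ℕ} (ht : StrictMono t) {j : ℕ} (h : t 0 ≤ j) :
    ∃ n, t n ≤ j ∧ j < t (n + 1) := by
  have hex : ∃ n, j < t (n + 1) := ⟨j, ht.le_apply⟩
  obtain ⟨h4, h5⟩ := (Nat.find_eq_iff hex).1 rfl
  refine ⟨_, ?_, h4⟩
  rcases Nat.eq_zero_or_pos (Nat.find hex) with h0 | h0
  · rw [h0]; exact h
  · have := h5 (Nat.find hex - 1) (by omega)
    rw [Nat.sub_add_cancel h0] at this
    omega

theorem walk_induction {v : ℕ → Γ} {t : ℕ → ℕ} (ht : StrictMono t) {p : ℕ → Γ → Prop}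
    (h0 : ∀ j < t 0, p j 1) (h1 : ∀ n j, t n ≤ j → p j (v n)) (j : ℕ) : p j (walk v t j) := by
  rcases lt_or_ge j (t 0) with h | h
  · rw [walk_of_lt h]; exact h0 j h
  · obtain ⟨n, hn, hn'⟩ := exists_index ht h
    rw [walk_eq ht hn hn']
    exact h1 n j hn

section Walk

variable {K : ℕ → Finset Γ} {l : ℕ → ℕ} {i₀ : ℕ} {Θ : (ℕ → Γ) → ℕ → PlaneSemi Λ}

/-- Multiplying `z` by `a` from the coordinate `T` on stays inside `K`, and changes `Θ z` after
`l T` by a nearly constant factor only. -/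
def Adapted (K : ℕ → Finset Γ) (l : ℕ → ℕ) (Θ : (ℕ → Γ) → ℕ → PlaneSemi Λ) (z : ℕ → Γ) (a : Γ)
    (n T : ℕ) : Prop :=
  ∃ y : ℕ → Γ, (∀ j, y j ∈ K j) ∧ (∀ j, T ≤ j → y j = a * z j) ∧
    ∃ ζ, NearConst (Set.Ici (l T)) ζ ((1 / 2) ^ n) (Θ y) (Θ z)

theorem walk_mul_mem {z : ℕ → Γ} (hz : ∀ j, z j ∈ K j) {v : ℕ → Γ} {t : ℕ → ℕ}
    (ht : StrictMono t) (hv : ∀ n, Adapted K l Θ z (v n) n (t n)) (j : ℕ) :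
    walk v t j * z j ∈ K j := by
  refine walk_induction ht (p := fun j g => g * z j ∈ K j) (fun j _ => ?_) (fun n j hj => ?_) j
  · simpa using hz j
  · obtain ⟨y, hy, hyz, -⟩ := hv n
    rw [← hyz j hj]
    exact hy j

/-- Between two jumps of a walk `x`, the quotient `Θ (x z) / Θ z` is nearly constant. -/
theorem Controlled.nearConst_plateau (hΘ : Controlled K l i₀ Θ) {z : ℕ → Γ} (hz : ∀ j, z j ∈ K j)
    {v : ℕ → Γ} {t : ℕ → ℕ} (ht : StrictMono t) (hv : ∀ n, Adapted K l Θ z (v n) n (t n)) {n : ℕ}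
    (hn : i₀ ≤ t n) :
    ∃ ζ, NearConst (Set.Icc (l (t n + 1)) (l (t (n + 1) - 1))) ζ (4 * (1 / 2) ^ n)
      (Θ fun j => walk v t j * z j) (Θ z) := by
  have hlt : t n < t (n + 1) := ht (Nat.lt_succ_self n)
  obtain ⟨y, hy, hyz, ξ, hξ⟩ := hv n
  obtain ⟨ζ, hζ⟩ := hΘ.nearConst_of_agree (walk_mul_mem hz ht hv) hy hn
    (show t n ≤ t (n + 1) - 1 by omega) fun j h1 h2 => by
      rw [hyz j h1, walk_eq ht h1 (by omega)]
  have hsub : Set.Icc (l (t n + 1)) (l (t (n + 1) - 1)) ⊆ Set.Ici (l (t n)) := fun m hm =>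
    (hΘ.strictMono.monotone (Nat.le_succ _)).trans hm.1
  have h1 : ((1 : ℝ) / 2) ^ t n ≤ (1 / 2) ^ n :=
    pow_le_pow_of_le_one (by norm_num) (by norm_num) ht.le_apply
  -- The bound is 3 for comparing the walk with `y`, plus 1 for comparing `y` with `z`.
  exact ⟨_, (hζ.comp (hξ.mono hsub le_rfl)).mono le_rfl (by linarith)⟩

/-- If `x` and `x'` are the same walk with interlaced jump times and `Θ (x z)`, `Θ (x' z)` are
equivalent, then the rotation part of `Θ (x z) / Θ z` is eventually constant. -/
theorem Controlled.eventually_rotPart_walk (hΘ : Controlled K l i₀ Θ) {z : ℕ → Γ}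
    (hz : ∀ j, z j ∈ K j) {v : ℕ → Γ} {t t' : ℕ → ℕ} (ht : StrictMono t) (ht' : StrictMono t')
    (htt : ∀ n, t n + 2 ≤ t' n) (htt' : ∀ n, t' n + 2 ≤ t (n + 1))
    (hv : ∀ n, Adapted K l Θ z (v n) n (t n)) (hv' : ∀ n, Adapted K l Θ z (v n) n (t' n))
    (hE : inducedEquiv (PlaneSemi Λ) (Θ fun j => walk v t j * z j)
      (Θ fun j => walk v t' j * z j)) :
    ∃ D, ∀ᶠ m in atTop, rotPart (Θ (fun j => walk v t j * z j) m) = D * rotPart (Θ z m) := by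
  have hΛ := hΘ.isRotationGroup
  have hl := hΘ.strictMono.monotone
  obtain ⟨w, hw, -⟩ := (hΛ.inducedEquiv_iff _ _).1 hE
  obtain ⟨M, hM⟩ := eventually_atTop.1 hw
  set X := Θ fun j => walk v t j * z j
  set X' := Θ fun j => walk v t' j * z j
  let ρ : ℕ → ℂ := fun m => rotPart (X m) * (rotPart (Θ z m))⁻¹
  have hρ : ∀ m a, rotPart (X m) = a * rotPart (Θ z m) → ρ m = a := fun m a h => by
    simp only [ρ]
    rw [h, mul_inv_cancel_right₀ (hΛ.rotPart_ne_zero _)]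
  have hb : StrictMono fun n => l (t n + 1) := fun a b h =>
    hΘ.strictMono (Nat.succ_lt_succ (ht h))
  obtain ⟨D, hD⟩ := eventually_eq_of_piecewise_const (γ := ρ) hb (N := i₀ + M) (by
    intro n hn m h1 h2
    have hle : n ≤ t n := ht.le_apply
    have hle' : n ≤ t' n := ht'.le_apply
    have a1 := htt n
    have a2 := htt' n
    have a3 := htt (n + 1)
    obtain ⟨ζ, hζ⟩ := hΘ.nearConst_plateau hz ht hv (n := n) (by omega)
    obtain ⟨ξ, hξ⟩ := hΘ.nearConst_plateau hz ht' hv' (n := n) (by omega)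
    have e0 : ρ (l (t n + 1)) = ζ := hρ _ _ (hζ.rot _ ⟨le_rfl, hl (by omega)⟩)
    rw [e0]
    rcases le_total m (l (t (n + 1) - 1)) with h3 | h3
    · exact hρ _ _ (hζ.rot _ ⟨h1, h3⟩)
    · have key : ∀ m', l (t (n + 1) - 1) ≤ m' → m' ≤ l (t (n + 1) + 1) → ρ m' = w * ξ := by
        intro m' h4 h5
        have h6 : M ≤ m' := by
          have h7 : t n ≤ l (t n) := hΘ.strictMono.le_apply
          have h8 : l (t n) ≤ l (t (n + 1) - 1) := hl (by omega)
          omega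
        refine hρ _ _ ?_
        rw [hM m' h6, hξ.rot m' ⟨(hl (by omega)).trans h4, h5.trans (hl (by omega))⟩, mul_assoc]
      rw [key m h3 h2, ← key (l (t (n + 1) - 1)) le_rfl (hl (by omega))]
      exact hρ _ _ (hζ.rot _ ⟨hl (by omega), le_rfl⟩))
  refine ⟨D, ?_⟩
  filter_upwards [hD] with m hm
  rw [← hm, inv_mul_cancel_right₀ (hΛ.rotPart_ne_zero _)]

/-- A walk `x` whose jumps occur where the backgrounds `z₁` and `z₂` agree moves `Θ (x z₁)` and
`Θ (x z₂)` in the same way, up to a fixed rotation. -/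
theorem Controlled.exists_tendsto_walk_sub (hΘ : Controlled K l i₀ Θ) {z₁ z₂ : ℕ → Γ}
    (hz₁ : ∀ j, z₁ j ∈ K j) (hz₂ : ∀ j, z₂ j ∈ K j) {v : ℕ → Γ} {t : ℕ → ℕ} (ht : StrictMono t)
    (ht2 : ∀ n, i₀ + 2 + n ≤ t n) (htt : ∀ n, t n + 2 ≤ t (n + 1))
    (hv₁ : ∀ n, Adapted K l Θ z₁ (v n) n (t n)) (hv₂ : ∀ n, Adapted K l Θ z₂ (v n) n (t n))
    (hzz : ∀ n j, t n ≤ j + 2 → j ≤ t n + 1 → z₁ j = z₂ j) {E D₁ D₂ : ℂ}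
    (hE : ∀ n, rotPart (Θ z₁ (l (t n - 1))) = E * rotPart (Θ z₂ (l (t n - 1))))
    (hD₁ : ∀ᶠ m in atTop, rotPart (Θ (fun j => walk v t j * z₁ j) m) = D₁ * rotPart (Θ z₁ m))
    (hD₂ : ∀ᶠ m in atTop, rotPart (Θ (fun j => walk v t j * z₂ j) m) = D₂ * rotPart (Θ z₂ m)) :
    ∃ a, Tendsto (fun m =>
      (transPart (Θ (fun j => walk v t j * z₁ j) m) - D₁ * transPart (Θ z₁ m)) -
      D₁ * E * D₂⁻¹ *
        (transPart (Θ (fun j => walk v t j * z₂ j) m) - D₂ * transPart (Θ z₂ m)))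
      atTop (𝓝 a) := by
  have hΛ := hΘ.isRotationGroup
  have hl := hΘ.strictMono.monotone
  obtain ⟨M, hM⟩ := eventually_atTop.1 (hD₁.and hD₂)
  set X₁ := Θ fun j => walk v t j * z₁ j
  set X₂ := Θ fun j => walk v t j * z₂ j
  have hD₂0 : D₂ ≠ 0 := by
    intro h0
    have := (hM M le_rfl).2
    rw [h0, zero_mul] at this
    exact hΛ.rotPart_ne_zero _ this
  have hb : StrictMono fun n => l (t n - 1) := fun a b h => hΘ.strictMono (by
    have := ht h
    have := ht2 a
    omega)
  -- Each interval starts just before a jump: the window around the jump contributes 6 and the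
  -- plateau after it 8, so 32 is a generous constant.
  refine exists_tendsto_of_geometric_oscillation hb (N := M) (C := 32) ?_
  intro n hn m h1 h2
  have hle := ht2 n
  have a1 := htt n
  have hpow : ((1 : ℝ) / 2) ^ (t n - 2) ≤ (1 / 2) ^ n :=
    pow_le_pow_of_le_one (by norm_num) (by norm_num) (by omega)
  have hge : ∀ m', l (t n - 1) ≤ m' → M ≤ m' := by
    intro m' hm'
    have h7 : t n - 1 ≤ l (t n - 1) := hΘ.strictMono.le_apply
    omega
  have hsucc : t n - 2 + 1 = t n - 1 := by omega
  -- Locality loses one index at the left end, so agreement from `t n - 2` gives control from `l (t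
  -- n - 1)`.
  obtain ⟨ε, hε⟩ := hΘ.nearConst_of_agree hz₁ hz₂ (i := t n - 2) (i' := t n + 1) (by omega)
    (by omega) fun j h3 h4 => hzz n j (by omega) h4
  obtain ⟨φ, hφ⟩ := hΘ.nearConst_of_agree (walk_mul_mem hz₁ ht hv₁) (walk_mul_mem hz₂ ht hv₂)
    (i := t n - 2) (i' := t n + 1) (by omega) (by omega)
    fun j h3 h4 => by rw [hzz n j (by omega) h4]
  rw [hsucc] at hε hφ
  have hmem : l (t n - 1) ∈ Set.Icc (l (t n - 1)) (l (t n + 1)) := ⟨le_rfl, hl (by omega)⟩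
  have hmem' : l (t n + 1) ∈ Set.Icc (l (t n - 1)) (l (t n + 1)) := ⟨hl (by omega), le_rfl⟩
  have eE : ε = E := hΛ.eq_of_rotPart_eq_mul (hε.rot _ hmem) (hE n)
  have eF : φ = D₁ * E * D₂⁻¹ := by
    refine hΛ.eq_of_rotPart_eq_mul (hφ.rot _ hmem) ?_
    obtain ⟨b1, b2⟩ := hM _ (hge _ le_rfl)
    rw [b1, b2, hE n]
    field_simp
  obtain ⟨δ₁, hδ₁⟩ := hΘ.nearConst_plateau hz₁ ht hv₁ (n := n) (by omega)
  obtain ⟨δ₂, hδ₂⟩ := hΘ.nearConst_plateau hz₂ ht hv₂ (n := n) (by omega)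
  have hmemJ : l (t n + 1) ∈ Set.Icc (l (t n + 1)) (l (t (n + 1) - 1)) := ⟨le_rfl, hl (by omega)⟩
  have eD₁ : δ₁ = D₁ := hΛ.eq_of_rotPart_eq_mul (hδ₁.rot _ hmemJ) (hM _ (hge _ (hl (by omega)))).1
  have eD₂ : δ₂ = D₂ := hΛ.eq_of_rotPart_eq_mul (hδ₂.rot _ hmemJ) (hM _ (hge _ (hl (by omega)))).2
  subst eE eD₁ eD₂
  rw [← eF]
  set γ : ℕ → ℂ := fun m => (transPart (X₁ m) - δ₁ * transPart (Θ z₁ m)) -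
      φ * (transPart (X₂ m) - δ₂ * transPart (Θ z₂ m)) with hγ
  have hwin : ∀ m ∈ Set.Icc (l (t n - 1)) (l (t n + 1)), ∀ m' ∈ Set.Icc (l (t n - 1)) (l (t n + 1)),
      ‖γ m - γ m'‖ ≤ 6 * (1 / 2) ^ n := by
    intro m hm m' hm'
    have b1 := hφ.trans m hm m' hm'
    have b2 := hε.trans m hm m' hm'
    -- Across the jump neither walk is comparable with its own background, so the terms are
    -- regrouped to compare walk with walk and background with background. The coefficients match
    -- because `φ * δ₂ = δ₁ * ε`.
    have e : γ m - γ m' = ((transPart (X₁ m) - φ * transPart (X₂ m)) -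
        (transPart (X₁ m') - φ * transPart (X₂ m'))) -
        δ₁ * ((transPart (Θ z₁ m) - ε * transPart (Θ z₂ m)) -
          (transPart (Θ z₁ m') - ε * transPart (Θ z₂ m'))) := by
      have : φ * δ₂ = δ₁ * ε := by rw [eF]; field_simp
      simp only [hγ]
      linear_combination (transPart (Θ z₂ m) - transPart (Θ z₂ m')) * this
    rw [e]
    refine (norm_sub_le _ _).trans ?_
    rw [norm_mul, hδ₁.norm_eq, one_mul]
    linarith
  have hplat : ∀ m ∈ Set.Icc (l (t n + 1)) (l (t (n + 1) - 1)),
      ‖γ m - γ (l (t n + 1))‖ ≤ 8 * (1 / 2) ^ n := by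
    intro m hm
    have b1 := hδ₁.trans m hm _ hmemJ
    have b2 := hδ₂.trans m hm _ hmemJ
    have e : γ m - γ (l (t n + 1)) = ((transPart (X₁ m) - δ₁ * transPart (Θ z₁ m)) -
        (transPart (X₁ (l (t n + 1))) - δ₁ * transPart (Θ z₁ (l (t n + 1))))) -
        φ * ((transPart (X₂ m) - δ₂ * transPart (Θ z₂ m)) -
          (transPart (X₂ (l (t n + 1))) - δ₂ * transPart (Θ z₂ (l (t n + 1))))) := by
      simp only [hγ]
      ring
    rw [e]
    refine (norm_sub_le _ _).trans ?_
    rw [norm_mul, hφ.norm_eq, one_mul]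
    linarith
  have hp : (0 : ℝ) ≤ (1 / 2) ^ n := by positivity
  rcases le_total m (l (t n + 1)) with h3 | h3
  · exact (hwin m ⟨h1, h3⟩ _ hmem).trans (by linarith)
  · have e : γ m - γ (l (t n - 1)) =
        (γ m - γ (l (t n + 1))) + (γ (l (t n + 1)) - γ (l (t n - 1))) := by ring
    show ‖γ m - γ (l (t n - 1))‖ ≤ _
    rw [e]
    exact (norm_add_le _ _).trans (by linarith [hplat m ⟨h3, h2⟩, hwin _ hmem' _ hmem])

end Walk

end

section Walk

variable {Λ : Subgroup (GL (Fin 2) ℝ)} {Γ : Type*} [Group Γ]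
  {K : ℕ → Finset Γ} {l : ℕ → ℕ} {i₀ : ℕ} {Θ : (ℕ → Γ) → ℕ → PlaneSemi Λ}

/-- A fixed left factor `a` gives a sequence related to `z`, so its image has a quotient by `Θ z`
that settles down. Finitely many coordinates are left unmultiplied to stay inside `K`. -/
theorem Controlled.eventually_adapted (hΘ : Controlled K l i₀ Θ) {z : ℕ → Γ}
    (hz : ∀ j, z j ∈ K j) {a : Γ} (ha : ∀ᶠ j in atTop, a * z j ∈ K j)
    (hrel : ∀ y : ℕ → Γ, (∀ j, y j ∈ K j) → (∀ᶠ j in atTop, y j = a * z j) →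
      inducedEquiv (PlaneSemi Λ) (Θ y) (Θ z)) (n : ℕ) :
    ∀ᶠ T in atTop, Adapted K l Θ z a n T := by
  classical
  have hΛ := hΘ.isRotationGroup
  obtain ⟨T₁, hT₁⟩ := eventually_atTop.1 ha
  let y : ℕ → Γ := fun j => if T₁ ≤ j then a * z j else z j
  have hy : ∀ j, y j ∈ K j := by
    intro j
    by_cases h : T₁ ≤ j
    · simpa [y, h] using hT₁ j h
    · simpa [y, h] using hz j
  have hyz : ∀ j ≥ T₁, y j = a * z j := fun j hj => if_pos hj
  obtain ⟨ζ, hζ, w, hw⟩ := (hΛ.inducedEquiv_iff _ _).1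
    (hrel y hy (eventually_atTop.2 ⟨T₁, hyz⟩))
  obtain ⟨M, hM⟩ := eventually_atTop.1 hζ
  obtain ⟨M', hM'⟩ := Metric.cauchySeq_iff.1 hw.cauchySeq ((1 / 2) ^ n) (by positivity)
  have hnorm : ‖ζ‖ = 1 := by
    have := congrArg norm (hM M le_rfl)
    rwa [norm_mul, hΛ.norm_rotPart, hΛ.norm_rotPart, mul_one, eq_comm] at this
  filter_upwards [eventually_ge_atTop (T₁ + M + M')] with T hT
  have hlT : T ≤ l T := hΘ.strictMono.le_apply
  refine ⟨y, hy, fun j hj => hyz j (by omega), ζ, hnorm, fun m hm => hM m ?_,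
    fun m hm m' hm' => ?_⟩
  · have : l T ≤ m := hm
    omega
  · have h1 : l T ≤ m := hm
    have h2 : l T ≤ m' := hm'
    have := hM' m (by omega) m' (by omega)
    rw [dist_eq_norm] at this
    exact this.le

/-- The two walks differ only between `t n` and `t' n`, where their values are consecutive terms of
`v`; the quotient therefore tends to the identity. -/
theorem exists_tendsto_walk_div (hΛ : IsRotationGroup Λ) {ι : Γ →* PlaneSemi Λ} {v : ℕ → Γ}
    {t t' : ℕ → ℕ} (ht : StrictMono t) (ht' : StrictMono t') (h1 : ∀ n, t n ≤ t' n)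
    (h2 : ∀ n, t' n ≤ t (n + 1)) (hrot : ∀ n, rotPart (ι (v n)) = 1)
    (htr : Tendsto (fun n => transPart (ι (v (n + 1))) - transPart (ι (v n))) atTop (𝓝 0)) :
    ∃ g, Tendsto (fun j => ι (walk v t j * (walk v t' j)⁻¹)) atTop (𝓝 g) := by
  have hr : ∀ (t : ℕ → ℕ), StrictMono t → ∀ j, rotPart (ι (walk v t j)) = 1 := fun t ht =>
    walk_induction ht (p := fun _ g => rotPart (ι g) = 1)
      (fun j _ => by rw [map_one, rotPart_one]) fun n j _ => hrot n
  have htp : ∀ j, transPart (ι (walk v t j * (walk v t' j)⁻¹)) =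
      transPart (ι (walk v t j)) - transPart (ι (walk v t' j)) := by
    intro j
    rw [map_mul, map_inv, hΛ.transPart_div, hr t ht, hr t' ht', inv_one, mul_one, one_mul]
  refine (hΛ.exists_tendsto_iff _).2 ⟨⟨1, Eventually.of_forall fun j => ?_⟩, 0, ?_⟩
  · rw [map_mul, map_inv, hΛ.rotPart_div, hr t ht, hr t' ht', inv_one, mul_one]
  · simp only [htp]
    rw [Metric.tendsto_atTop]
    intro ε hε
    obtain ⟨N, hN⟩ := Metric.tendsto_atTop.1 htr ε hε
    refine ⟨t (N + 1), fun j hj => ?_⟩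
    obtain ⟨n, hn, hn'⟩ := exists_index ht ((ht.monotone (Nat.zero_le _)).trans hj)
    have hNn : N + 1 ≤ n := Nat.lt_succ_iff.1 (ht.lt_iff_lt.1 (hj.trans_lt hn'))
    rw [walk_eq ht hn hn']
    rcases le_or_gt (t' n) j with h | h
    · rw [walk_eq ht' h (hn'.trans_le (h1 (n + 1)))]
      simpa using hε
    · obtain ⟨n, rfl⟩ : ∃ n', n = n' + 1 := ⟨n - 1, by omega⟩
      rw [walk_eq ht' ((h2 n).trans hn) h]
      exact hN n (by omega)

end Walk

/-! ### Pigeonhole on conjugated walks -/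

theorem pow_eq_one_of_eventually_rotPart {k : ℕ} (hk : k ≠ 0) {X Y : ℕ → PlaneSemi (GammaFin k)}
    {a : ℂ} (h : ∀ᶠ m in atTop, rotPart (X m) = a * rotPart (Y m)) : a ^ k = 1 := by
  obtain ⟨m, hm⟩ := h.exists
  have := congrArg (· ^ k) hm
  simp only [mul_pow, rotPart, rotNum_gammaFin_pow hk, mul_one] at this
  exact this.symm

theorem tendsto_sqrt_succ_sub_sqrt :
    Tendsto (fun n : ℕ => ((√((n + 1 : ℕ) : ℝ) : ℝ) : ℂ) - ((√(n : ℝ) : ℝ) : ℂ)) atTop (𝓝 0) := by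
  have h : Tendsto (fun n : ℕ => √((n + 1 : ℕ) : ℝ) - √(n : ℝ)) atTop (𝓝 0) := by
    have h0 : Tendsto (fun n : ℕ => (√((n + 1 : ℕ) : ℝ))⁻¹) atTop (𝓝 0) :=
      (tendsto_inv_atTop_zero.comp Real.tendsto_sqrt_atTop).comp
        (tendsto_natCast_atTop_atTop.comp (tendsto_add_atTop_nat 1))
    refine squeeze_zero (fun n => ?_) (fun n => ?_) h0
    · exact sub_nonneg.2 (Real.sqrt_le_sqrt (by push_cast; linarith))
    · have h1 : 0 < √((n + 1 : ℕ) : ℝ) := Real.sqrt_pos.2 (by positivity)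
      have h2 := Real.sq_sqrt (show (0 : ℝ) ≤ ((n + 1 : ℕ) : ℝ) by positivity)
      have h3 := Real.sq_sqrt (show (0 : ℝ) ≤ (n : ℝ) by positivity)
      have h4 := Real.sqrt_nonneg (n : ℝ)
      rw [← one_div, le_div_iff₀ h1]
      push_cast at *
      have h5 : √(n : ℝ) ≤ √((n : ℝ) + 1) := Real.sqrt_le_sqrt (by linarith)
      nlinarith
  have := (Complex.continuous_ofReal.tendsto 0).comp h
  simpa [Function.comp_def] using this

/-- The equivalence relation on `Γ`-valued sequences cannot be carried by a controlled map into
`Γ_k ⋉ ℝ²`. -/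
theorem Controlled.false {k : ℕ} (hk : k ≠ 0) {Γ : Type*} [Group Γ] {ι : Γ →* PlaneSemi GammaZ}
    {c : Γ} {σ : ℕ → Γ} (hc : rotPart (ι c) = unitExp √2) (hc0 : transPart (ι c) = 0)
    (hσ : ∀ n, rotPart (ι (σ n)) = 1) (hσ' : ∀ n, transPart (ι (σ n)) = (√(n : ℝ) : ℝ))
    {N : ℕ} (hN : ((finite_pow_eq_one hk).toFinset ×ˢ (finite_pow_eq_one hk).toFinset).card < N)
    {K : ℕ → Finset Γ} {l : ℕ → ℕ} {i₀ : ℕ} {Θ : (ℕ → Γ) → ℕ → PlaneSemi (GammaFin k)}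
    (hΘ : Controlled K l i₀ Θ) (hKu : ∀ a, ∀ᶠ j in atTop, a ∈ K j)
    (hKc : ∀ p < N, ∀ j, c ^ p ∈ K j)
    (hrel : ∀ x y : ℕ → Γ, (∀ j, x j ∈ K j) → (∀ j, y j ∈ K j) →
      (inducedEquiv _ (Θ x) (Θ y) ↔ ∃ g, Tendsto (fun j => ι (x j * (y j)⁻¹)) atTop (𝓝 g))) :
    False := by
  have hG := isRotationGroup_gammaFin k
  have hH := isRotationGroup_gammaZ
  have hN2 : 1 < N := by
    refine lt_of_le_of_lt (Finset.card_pos.2 ⟨(1, 1), ?_⟩) hN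
    simp
  -- the backgrounds
  let bg : ℕ → ℕ → Γ := fun p _ => c ^ p
  -- The cyclic background holds each `c ^ p` on windows of length 4, just enough for the interval
  -- from `t - 2` to `t + 1` required around a jump.
  let zz : ℕ → Γ := fun j => c ^ (j / 4 % N)
  have hbg : ∀ p < N, ∀ j, bg p j ∈ K j := fun p hp j => hKc p hp j
  have hzz : ∀ j, zz j ∈ K j := fun j => hKc _ (Nat.mod_lt _ (by omega)) j
  have hKzz : ∀ a, ∀ᶠ j in atTop, a * zz j ∈ K j := by
    intro a
    have : ∀ᶠ j in atTop, ∀ p ∈ Finset.range N, a * c ^ p ∈ K j :=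
      (Finset.eventually_all _).2 fun p _ => hKu _
    filter_upwards [this] with j hj
    exact hj _ (Finset.mem_range.2 (Nat.mod_lt _ (by omega)))
  have hrelz : ∀ z : ℕ → Γ, (∀ j, z j ∈ K j) → ∀ (a : Γ) (y : ℕ → Γ), (∀ j, y j ∈ K j) →
      (∀ᶠ j in atTop, y j = a * z j) → inducedEquiv _ (Θ y) (Θ z) := by
    intro z hz a y hy h
    refine (hrel y z hy hz).2 ⟨ι a, tendsto_const_nhds.congr' ?_⟩
    filter_upwards [h] with j hj
    rw [hj, mul_inv_cancel_right]
  -- the jump times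
  have hQ : ∀ n, ∀ᶠ T in atTop, Adapted K l Θ zz (σ n) n T ∧ ∀ p ∈ Finset.range N,
      Adapted K l Θ (bg p) (σ n) n T ∧ (c ^ p)⁻¹ * σ n * c ^ p ∈ K T := by
    intro n
    refine (hΘ.eventually_adapted hzz (hKzz _) (hrelz zz hzz _) n).and
      ((Finset.eventually_all _).2 fun p hp => ?_)
    have hp' := Finset.mem_range.1 hp
    exact (hΘ.eventually_adapted (hbg p hp') (hKu (σ n * c ^ p)) (hrelz _ (hbg p hp') _) n).and (hKu _)
  choose B hB using fun n => eventually_atTop.1 (hQ n)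
  let S := {z : ℂ | z ^ k = 1}
  have : Finite S := finite_pow_eq_one hk
  have hSdiv : ∀ g h : PlaneSemi (GammaFin k), rotPart g * (rotPart h)⁻¹ ∈ S := by
    intro g h
    show _ = _
    rw [mul_pow, inv_pow, rotPart, rotPart, rotNum_gammaFin_pow hk, rotNum_gammaFin_pow hk,
      inv_one, mul_one]
  -- Rotation quotient of the two backgrounds at the start of the p-th window of cycle `n`. It takes
  -- finitely many values, so a subsequence of cycles makes it independent of `n`, as
  -- `exists_tendsto_walk_sub` demands of `E`; the same subsequence can be made as sparse as `B`
  -- requires.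
  let f : ℕ → Fin N → S := fun n p => ⟨_, hSdiv (Θ zz (l (4 * (n * N + p) + 1)))
    (Θ (bg p) (l (4 * (n * N + p) + 1)))⟩
  obtain ⟨V, hV⟩ := Finite.exists_infinite_fiber f
  obtain ⟨s, hs, hsP⟩ := extraction_forall_of_frequently
    (P := fun n m => f m = V ∧ B n + i₀ + 2 + n ≤ m) fun n =>
      (Nat.frequently_atTop_iff_infinite.2 (Set.infinite_coe_iff.1 hV)).and_eventually
        (eventually_ge_atTop _)
  have hA1 : ∀ n, s n ≤ s n * N := fun n => Nat.le_mul_of_pos_right _ (by omega)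
  have hA2 : ∀ n, s n * N + N ≤ s (n + 1) * N := by
    intro n
    rw [← Nat.succ_mul]
    exact Nat.mul_le_mul_right N (hs (Nat.lt_succ_self n))
  -- The third coordinate of the `c ^ p`-window in cycle `s n`. For different `p` these jump times
  -- interlace.
  let t : ℕ → ℕ → ℕ := fun p n => 4 * (s n * N + p) + 2
  have ht : ∀ p, StrictMono (t p) := fun p => strictMono_nat_of_lt_succ fun n => by
    have := hA2 n
    simp only [t]
    omega
  have htB : ∀ p n, B n + i₀ + 2 + n ≤ t p n := by
    intro p n
    have := (hsP n).2
    have := hA1 n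
    simp only [t]
    omega
  have hadz : ∀ p n, Adapted K l Θ zz (σ n) n (t p n) := fun p n =>
    (hB n _ (by have := htB p n; omega)).1
  have hadb : ∀ p < N, ∀ q n, Adapted K l Θ (bg p) (σ n) n (t q n) := fun p hp q n =>
    ((hB n _ (by have := htB q n; omega)).2 p (Finset.mem_range.2 hp)).1
  have hconj : ∀ p < N, ∀ n j, t p n ≤ j → (c ^ p)⁻¹ * σ n * c ^ p ∈ K j := fun p hp n j hj =>
    ((hB n _ (by have := htB p n; omega)).2 p (Finset.mem_range.2 hp)).2
  -- walks with different jump times are equivalent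
  have hdiff : Tendsto (fun n => transPart (ι (σ (n + 1))) - transPart (ι (σ n))) atTop (𝓝 0) := by
    simp only [hσ']
    exact tendsto_sqrt_succ_sub_sqrt
  have hwalk : ∀ z : ℕ → Γ, (∀ j, z j ∈ K j) → (∀ p n, Adapted K l Θ z (σ n) n (t p n)) →
      ∀ p < N, inducedEquiv _ (Θ fun j => walk σ (t 0) j * z j)
        (Θ fun j => walk σ (t p) j * z j) := by
    intro z hz hz' p hp
    refine (hrel _ _ (walk_mul_mem hz (ht 0) (hz' 0)) (walk_mul_mem hz (ht p) (hz' p))).2 ?_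
    have h1 : ∀ j, walk σ (t 0) j * z j * (walk σ (t p) j * z j)⁻¹ =
        walk σ (t 0) j * (walk σ (t p) j)⁻¹ := fun j => by group
    simp only [h1]
    refine exists_tendsto_walk_div hH (ht 0) (ht p) (fun n => ?_) (fun n => ?_) hσ hdiff
    · simp only [t]; omega
    · have := hA2 n
      simp only [t]; omega
  have hrot0 : ∀ z : ℕ → Γ, (∀ j, z j ∈ K j) → (∀ p n, Adapted K l Θ z (σ n) n (t p n)) →
      ∃ D, ∀ᶠ m in atTop,
        rotPart (Θ (fun j => walk σ (t 0) j * z j) m) = D * rotPart (Θ z m) := by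
    intro z hz hz'
    -- The walk with times `t 1` serves as the interlaced companion; this is why `1 < N` is needed.
    refine hΘ.eventually_rotPart_walk hz (ht 0) (ht 1) (fun n => ?_) (fun n => ?_) (hz' 0) (hz' 1)
      (hwalk z hz hz' 1 hN2)
    · simp only [t]; omega
    · have := hA2 n
      simp only [t]; omega
  obtain ⟨D₀, hD₀⟩ := hrot0 zz hzz hadz
  have h1K : ∀ j, (1 : Γ) ∈ K j := fun j => by simpa using hKc 0 (by omega) j
  let one : ℕ → Γ := fun _ => 1
  -- Pulling `c ^ p` to the left turns the walk on the constant background `c ^ p` into this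
  -- conjugate on the trivial background; a constant left factor does not change the class.
  let y : ℕ → ℕ → Γ := fun p j => (c ^ p)⁻¹ * walk σ (t p) j * c ^ p
  have hy : ∀ p < N, ∀ j, y p j ∈ K j := fun p hp =>
    walk_induction (ht p) (p := fun j g => (c ^ p)⁻¹ * g * c ^ p ∈ K j)
      (fun j _ => by simpa using h1K j) fun n j hj => hconj p hp n j hj
  -- The left-hand path does not depend on `p`. The chain is: move the jumps from `t 0` to `t p`,
  -- replace `zz` by `bg p`, then conjugate. Each link costs only k-th roots of unity and a
  -- convergent error.
  have claim : ∀ p < N, ∃ Φ D : ℂ, Φ ^ k = 1 ∧ D ^ k = 1 ∧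
      (∀ᶠ m in atTop, rotPart (Θ (y p) m) = D * rotPart (Θ one m)) ∧
      ∃ a, Tendsto (fun m => (transPart (Θ (fun j => walk σ (t 0) j * zz j) m) -
        D₀ * transPart (Θ zz m)) - Φ * (transPart (Θ (y p) m) - D * transPart (Θ one m)))
        atTop (𝓝 a) := by
    intro p hp
    obtain ⟨r, hr, a₁, ha₁⟩ := (hG.inducedEquiv_iff _ _).1
      (Setoid.symm' _ (hwalk zz hzz hadz p hp))
    obtain ⟨D', hD'⟩ := hrot0 (bg p) (hbg p hp) (hadb p hp)
    obtain ⟨r', hr', -⟩ := (hG.inducedEquiv_iff _ _).1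
      (Setoid.symm' _ (hwalk (bg p) (hbg p hp) (hadb p hp) p hp))
    have hD₁ : ∀ᶠ m in atTop,
        rotPart (Θ (fun j => walk σ (t p) j * zz j) m) = r * D₀ * rotPart (Θ zz m) := by
      filter_upwards [hr, hD₀] with m h1 h2
      rw [h1, h2, mul_assoc]
    have hD₂ : ∀ᶠ m in atTop,
        rotPart (Θ (fun j => walk σ (t p) j * bg p j) m) = r' * D' * rotPart (Θ (bg p) m) := by
      filter_upwards [hr', hD'] with m h1 h2
      rw [h1, h2, mul_assoc]
    have hE : ∀ n, rotPart (Θ zz (l (t p n - 1))) =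
        (V ⟨p, hp⟩ : ℂ) * rotPart (Θ (bg p) (l (t p n - 1))) := by
      intro n
      have h1 : (f (s n) ⟨p, hp⟩ : ℂ) = V ⟨p, hp⟩ := by rw [(hsP n).1]
      rw [← h1]
      exact (inv_mul_cancel_right₀ (hG.rotPart_ne_zero _) _).symm
    obtain ⟨a₂, ha₂⟩ := hΘ.exists_tendsto_walk_sub hzz (hbg p hp) (ht p)
      (fun n => by have := htB p n; omega) (fun n => by
        have := hA2 n
        simp only [t]; omega) (hadz p) (hadb p hp p) (fun n j h1 h2 => by
          simp only [zz, bg]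
          have h3 : j / 4 = p + N * s n := by
            simp only [t] at h1 h2
            rw [mul_comm N]
            omega
          rw [h3, Nat.add_mul_mod_self_left, Nat.mod_eq_of_lt hp]) hE hD₁ hD₂
    have hyE : inducedEquiv _ (Θ fun j => walk σ (t p) j * bg p j) (Θ (y p)) :=
      hrelz (y p) (hy p hp) (c ^ p) _ (walk_mul_mem (hbg p hp) (ht p) (hadb p hp p))
        (Eventually.of_forall fun j => by simp only [y, bg]; group)
    obtain ⟨u, hu, a₃, ha₃⟩ := (hG.inducedEquiv_iff _ _).1 hyE
    have hbE : inducedEquiv _ (Θ (bg p)) (Θ one) :=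
      hrelz one h1K (c ^ p) _ (hbg p hp) (Eventually.of_forall fun j => by simp [one, bg])
    obtain ⟨u', hu', a₄, ha₄⟩ := (hG.inducedEquiv_iff _ _).1 hbE
    have hrk := pow_eq_one_of_eventually_rotPart hk hr
    have huk := pow_eq_one_of_eventually_rotPart hk hu
    have huk' := pow_eq_one_of_eventually_rotPart hk hu'
    have hD₁k := pow_eq_one_of_eventually_rotPart hk hD₁
    have hD₂k := pow_eq_one_of_eventually_rotPart hk hD₂
    have hVk : (V ⟨p, hp⟩ : ℂ) ^ k = 1 := (V ⟨p, hp⟩).2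
    have hr0 : r ≠ 0 := fun h => by simp [h, hk] at hrk
    have hu0 : u ≠ 0 := fun h => by simp [h, hk] at huk
    set F : ℂ := r * D₀ * V ⟨p, hp⟩ * (r' * D')⁻¹ with hF
    have hFk : F ^ k = 1 := by
      rw [hF, mul_pow, mul_pow, hD₁k, hVk, inv_pow, hD₂k, inv_one, mul_one, mul_one]
    refine ⟨r⁻¹ * F * u, u⁻¹ * (r' * D') * u', ?_, ?_, ?_,
      r⁻¹ * (a₂ - a₁ + F * a₃ - F * (r' * D') * a₄), ?_⟩
    · rw [mul_pow, mul_pow, inv_pow, hrk, hFk, huk, inv_one, one_mul, mul_one]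
    · rw [mul_pow, mul_pow, inv_pow, huk, hD₂k, huk', inv_one, one_mul, mul_one]
    · filter_upwards [hu, hu', hD₂] with m h1 h2 h3
      rw [h1, h2] at h3
      refine mul_left_cancel₀ hu0 (h3.trans ?_)
      field_simp
    · refine ((((ha₂.sub ha₁).add (ha₃.const_mul F)).sub
        (ha₄.const_mul (F * (r' * D')))).const_mul r⁻¹).congr fun m => ?_
      field_simp
      ring
  -- pigeonhole
  choose! Φ D hΦ hD hrotD hconv using claim
  obtain ⟨p, hp, q, hq, hpq, heq⟩ := Finset.exists_ne_map_eq_of_card_lt_of_maps_to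
    (s := Finset.range N) (by rwa [Finset.card_range]) (f := fun p => (Φ p, D p))
    (fun p hp => by
      have hp' := Finset.mem_range.1 hp
      simp [hΦ p hp', hD p hp'])
  rw [Finset.mem_range] at hp hq
  obtain ⟨hΦe, hDe⟩ := Prod.mk.inj heq
  have hΦ0 : Φ q ≠ 0 := fun h => by have := hΦ q hq; simp [h, hk] at this
  have hyy : inducedEquiv _ (Θ (y p)) (Θ (y q)) := by
    refine (hG.inducedEquiv_iff _ _).2 ⟨1, ?_, ?_⟩
    · filter_upwards [hrotD p hp, hrotD q hq] with m h1 h2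
      rw [h1, h2, hDe, one_mul]
    · obtain ⟨a, ha⟩ := hconv p hp
      obtain ⟨b, hb⟩ := hconv q hq
      refine ⟨(Φ q)⁻¹ * (b - a), ((hb.sub ha).const_mul (Φ q)⁻¹).congr fun m => ?_⟩
      rw [hΦe, hDe]
      field_simp
      ring
  obtain ⟨-, w, hw⟩ := (hH.exists_tendsto_iff _).1 ((hrel _ _ (hy p hp) (hy q hq)).1 hyy)
  -- the translation parts of `y p` and `y q`
  set ω := unitExp √2 with hω
  have hω0 : ω ≠ 0 := unitExp_ne_zero _
  have hcp : ∀ p, rotPart (ι (c ^ p)) = ω ^ p ∧ transPart (ι (c ^ p)) = 0 := by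
    intro p
    induction p with
    | zero => simp [rotPart_one, transPart_one]
    | succ p ih =>
      rw [pow_succ, map_mul, hH.rotPart_mul, hH.transPart_mul, ih.1, ih.2, hc, hc0]
      simp [pow_succ]
  have hyval : ∀ p n, rotPart (ι ((c ^ p)⁻¹ * σ n * c ^ p)) = 1 ∧
      transPart (ι ((c ^ p)⁻¹ * σ n * c ^ p)) = (ω ^ p)⁻¹ * (√(n : ℝ) : ℝ) := by
    intro p n
    have h0 : ω ^ p ≠ 0 := pow_ne_zero _ hω0
    constructor
    · rw [map_mul, map_mul, map_inv, hH.rotPart_mul, hH.rotPart_mul, hH.rotPart_inv, (hcp p).1,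
        hσ, mul_one, inv_mul_cancel₀ h0]
    · rw [map_mul, map_mul, map_inv, hH.transPart_mul, hH.transPart_mul, hH.transPart_inv,
        hH.rotPart_inv, (hcp p).1, (hcp p).2, hσ']
      simp
  -- The last coordinate of cycle `s n`: every walk with `p < N` has made its n-th jump and none has
  -- made the next.
  let J : ℕ → ℕ := fun n => 4 * (s n * N + N) - 1
  have hJ : ∀ p < N, ∀ n, y p (J n) = (c ^ p)⁻¹ * σ n * c ^ p := by
    intro p hp n
    have := hA2 n
    simp only [y]
    rw [walk_eq (ht p) (n := n) (by simp only [t, J]; omega) (by simp only [t, J]; omega)]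
  have hJt : Tendsto J atTop atTop := tendsto_atTop_mono (fun n => by
    have := hA1 n
    have : n ≤ s n := hs.le_apply
    simp only [J, id]
    omega) tendsto_id
  have hlim : Tendsto (fun n : ℕ => ((ω ^ p)⁻¹ - (ω ^ q)⁻¹) * ((√(n : ℝ) : ℝ) : ℂ)) atTop
      (𝓝 w) := by
    refine (hw.comp hJt).congr fun n => ?_
    simp only [Function.comp_apply]
    rw [hJ p hp, hJ q hq, map_mul ι ((c ^ p)⁻¹ * σ n * c ^ p), map_inv ι, hH.transPart_div,
      (hyval p n).1, (hyval q n).1, (hyval p n).2, (hyval q n).2]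
    ring
  have hne : ((ω ^ p)⁻¹ - (ω ^ q)⁻¹) ≠ 0 := by
    intro h
    have h1 : ω ^ p = ω ^ q := inv_injective (sub_eq_zero.1 h)
    have h2 : ∀ a b : ℕ, a < b → ω ^ a ≠ ω ^ b := by
      intro a b hab hab'
      have h3 : ω ^ (b - a) = 1 := by
        rw [pow_sub₀ _ hω0 hab.le, ← hab', mul_inv_cancel₀ (pow_ne_zero _ hω0)]
      have h4 : unitExp (√2 * (1 : ℤ)) ^ (b - a) = 1 := by simpa using h3
      exact one_ne_zero (unitExp_sqrt_two_mul_eq_one (by omega) h4)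
    rcases lt_or_gt_of_ne hpq with h | h
    · exact h2 _ _ h h1
    · exact h2 _ _ h h1.symm
  have hinf : Tendsto (fun n : ℕ => ‖((ω ^ p)⁻¹ - (ω ^ q)⁻¹) * ((√(n : ℝ) : ℝ) : ℂ)‖) atTop
      atTop := by
    have h1 : Tendsto (fun n : ℕ => √(n : ℝ)) atTop atTop :=
      Real.tendsto_sqrt_atTop.comp tendsto_natCast_atTop_atTop
    refine (h1.const_mul_atTop (norm_pos_iff.2 hne)).congr fun n => ?_
    rw [norm_mul, Complex.norm_real, Real.norm_of_nonneg (Real.sqrt_nonneg _)]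
  exact not_tendsto_nhds_of_tendsto_atTop hinf _ hlim.norm

/-! ### From a Borel reduction to a controlled map -/

theorem exists_rotPart_isolated {k : ℕ} (hk : k ≠ 0) : ∃ i₀ : ℕ, ∀ g h : PlaneSemi (GammaFin k),
    ‖rotPart g - rotPart h‖ ≤ (1 / 2) ^ i₀ → rotPart g = rotPart h := by
  have hfin := finite_pow_eq_one hk
  have h0 : ∀ a b : ℂ, ∀ᶠ i : ℕ in atTop, ‖a - b‖ ≤ (1 / 2) ^ i → a = b := by
    intro a b
    rcases eq_or_ne a b with rfl | hab
    · exact Eventually.of_forall fun _ _ => rfl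
    · filter_upwards [(tendsto_pow_atTop_nhds_zero_of_lt_one (r := (1 / 2 : ℝ)) (by norm_num)
        (by norm_num)).eventually_lt_const (norm_pos_iff.2 (sub_ne_zero.2 hab))] with i hi h
      exact absurd h (not_le.2 hi)
  have h1 := (eventually_all_finite hfin).2 fun a _ =>
    (eventually_all_finite hfin).2 fun b _ => h0 a b
  obtain ⟨i₀, hi₀⟩ := h1.exists
  exact ⟨i₀, fun g h => hi₀ _ (rotNum_gammaFin_pow hk _) _ (rotNum_gammaFin_pow hk _)⟩

/-- Repeating entries in blocks does not affect convergence; this removes the block structure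
introduced by the fusion. -/
theorem exists_tendsto_comp_iff {X : Type*} [TopologicalSpace X] {u : ℕ → X} {b : ℕ → ℕ}
    (hb : Monotone b) (hs : Function.Surjective b) :
    (∃ g, Tendsto (fun i => u (b i)) atTop (𝓝 g)) ↔ ∃ g, Tendsto u atTop (𝓝 g) := by
  have hbt : Tendsto b atTop atTop := tendsto_atTop_atTop.2 fun n => by
    obtain ⟨i, rfl⟩ := hs n
    exact ⟨i, fun j hj => hb hj⟩
  refine exists_congr fun g => ⟨fun h => ?_, fun h => h.comp hbt⟩
  refine tendsto_atTop'.2 fun U hU => ?_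
  obtain ⟨n, hn⟩ := tendsto_atTop'.1 h U hU
  refine ⟨b n + 1, fun j hj => ?_⟩
  obtain ⟨i, rfl⟩ := hs j
  exact hn i (le_of_lt (hb.reflect_lt hj))

theorem exists_exhaustion {Γ : Type*} [Nonempty Γ] [Countable Γ] (S : Finset Γ) :
    ∃ K : ℕ → Finset Γ, Monotone K ∧ (∀ j, S ⊆ K j) ∧ ∀ a, ∀ᶠ j in atTop, a ∈ K j := by
  classical
  obtain ⟨e, he⟩ := exists_surjective_nat Γ
  refine ⟨fun j => S ∪ (Finset.range (j + 1)).image e, fun i j hij => ?_,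
    fun j => Finset.subset_union_left, fun a => ?_⟩
  · exact Finset.union_subset_union_right
      (Finset.image_subset_image (Finset.range_subset_range.2 (by omega)))
  · obtain ⟨i, rfl⟩ := he a
    filter_upwards [eventually_ge_atTop i] with j hj
    exact Finset.mem_union_right _ (Finset.mem_image_of_mem _ (Finset.mem_range.2 (by omega)))

/-- A Borel reduction cannot exist as soon as a countable group maps onto a subgroup of
`Γ^z ⋉ ℝ²` that contains a generating rotation and the translations by `√n`. -/
theorem not_borelReducible_of_monoidHom {k : ℕ} (hk : k ≠ 0) {Γ : Type*} [Group Γ] [Countable Γ]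
    {ι : Γ →* PlaneSemi GammaZ} {c : Γ} {σ : ℕ → Γ} (hc : rotPart (ι c) = unitExp √2)
    (hc0 : transPart (ι c) = 0) (hσ : ∀ n, rotPart (ι (σ n)) = 1)
    (hσ' : ∀ n, transPart (ι (σ n)) = (√(n : ℝ) : ℝ)) :
    ¬ BorelReducible (inducedEquiv (PlaneSemi GammaZ))
      (inducedEquiv (PlaneSemi (GammaFin k))) := by
  classical
  rintro ⟨θ, hθ, hred⟩
  let : TopologicalSpace Γ := ⊥
  have : DiscreteTopology Γ := ⟨rfl⟩
  let Θ : (ℕ → Γ) → ℕ → PlaneSemi (GammaFin k) := fun u => θ fun i => ι (u i)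
  have hΘm : @Measurable _ _ (borel (ℕ → Γ)) (borel (ℕ → PlaneSemi (GammaFin k))) Θ := by
    borelize (ℕ → Γ)
    borelize (ℕ → PlaneSemi GammaZ)
    borelize (ℕ → PlaneSemi (GammaFin k))
    have hc : Continuous fun (u : ℕ → Γ) (i : ℕ) => ι (u i) :=
      continuous_pi fun i => (continuous_of_discreteTopology (f := ι)).comp (continuous_apply i)
    exact hθ.comp hc.measurable
  let d : PlaneSemi (GammaFin k) × PlaneSemi (GammaFin k) → ℝ := fun p =>
    ‖rotPart p.1 - rotPart p.2‖ + ‖transPart p.1 - transPart p.2‖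
  have hd : Continuous d :=
    ((continuous_rotPart.comp continuous_fst).sub (continuous_rotPart.comp continuous_snd)).norm.add
      ((continuous_transPart.comp continuous_fst).sub
        (continuous_transPart.comp continuous_snd)).norm
  have hΘE : ∀ u v : ℕ → Γ, inducedEquiv _ (Θ u) (Θ v) ↔
      ∃ g, Tendsto (fun i => ι (u i * (v i)⁻¹)) atTop (𝓝 g) := by
    intro u v
    refine (hred _ _).symm.trans ?_
    simp only [map_mul, map_inv]
    exact Iff.rfl
  let S := (finite_pow_eq_one hk).toFinset ×ˢ (finite_pow_eq_one hk).toFinset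
  obtain ⟨K, hKm, hKS, hKu⟩ := exists_exhaustion ((Finset.range (S.card + 1)).image fun p => c ^ p)
  obtain ⟨z, blk, l, hblk, hsurj, hl, hctrl⟩ := exists_fusion
    (secondCountableTopology_planeSemi (Λ := GammaFin k)) hΘm hd (fun g => by simp [d])
    (fun u v huv => (hΘE u v).2 ⟨1, tendsto_const_nhds.congr' (by
      filter_upwards [huv] with i hi
      rw [hi, mul_inv_cancel, map_one])⟩) K hKm
  obtain ⟨i₀, hi₀⟩ := exists_rotPart_isolated hk
  refine Controlled.false hk (c := c) (σ := σ) (ι := ι) (N := S.card + 1) (K := K) (l := l)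
    (i₀ := i₀) (Θ := fun x => Θ fun i => x (blk i) * z i) hc hc0 hσ hσ'
    (Nat.lt_succ_self _) ?_ hKu ?_ ?_
  · exact ⟨isRotationGroup_gammaFin k, hl, hi₀, fun x y hx hy j => (hctrl x y hx hy j).1,
      fun x y hx hy j => (hctrl x y hx hy j).2⟩
  · exact fun p hp j => hKS j (Finset.mem_image_of_mem _ (Finset.mem_range.2 hp))
  · intro x y _ _
    -- The generic sequence `z` acts on the right, so it cancels in the quotient and the relation on
    -- `x`, `y` survives the fusion.
    rw [hΘE, ← exists_tendsto_comp_iff (u := fun j => ι (x j * (y j)⁻¹)) hblk hsurj]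
    have : ∀ i, x (blk i) * z i * (y (blk i) * z i)⁻¹ = x (blk i) * (y (blk i))⁻¹ :=
      fun i => by group
    simp only [this]

/-- A free group is a countable group in which the images of the generators can be prescribed;
injectivity of the homomorphism plays no role. -/
theorem not_borelReducible_gammaZ_gammaFin {k : ℕ} (hk : k ≠ 0) :
    ¬ BorelReducible (inducedEquiv (PlaneSemi GammaZ))
      (inducedEquiv (PlaneSemi (GammaFin k))) := by
  let rotGen : GammaZ := ⟨rot (√2 * (1 : ℤ)), 1, rfl⟩
  let ι : FreeGroup (Option ℕ) →* PlaneSemi GammaZ := FreeGroup.lift fun o =>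
    Option.elim o (semiMk rotGen 0) fun n => semiMk 1 (√(n : ℝ) : ℝ)
  have hιc : ι (FreeGroup.of none) = semiMk rotGen 0 := FreeGroup.lift_apply_of
  have hισ : ∀ n, ι (FreeGroup.of (some n)) = semiMk 1 (√(n : ℝ) : ℝ) :=
    fun n => FreeGroup.lift_apply_of
  refine not_borelReducible_of_monoidHom hk (ι := ι) (c := FreeGroup.of none)
    (σ := fun n => FreeGroup.of (some n)) ?_ ?_ (fun n => ?_) fun n => ?_
  · rw [hιc, rotPart_semiMk, rotNum_rot, Int.cast_one, mul_one]
  · rw [hιc, transPart_semiMk]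
  · rw [hισ, rotPart_semiMk, OneMemClass.coe_one, ← rot_zero, rotNum_rot, unitExp_zero]
  · rw [hισ, transPart_semiMk]

end
end RigidTSI

open RigidTSI
theorem theorem1p2 (k : ℕ) (hk : 2 ≤ k) :
    StrictBorelReducible (inducedEquiv (PlaneSemi (GammaFin k)))
        (inducedEquiv (PlaneSemi GammaZ)) ∧
      ¬ ∃ φ : Subgroup.connectedComponentOfOne (PlaneSemi (GammaFin k)) ≃ₜ*
            Subgroup.connectedComponentOfOne (PlaneSemi GammaZ),
          (fun ι => (φ.symm.trans ι).trans φ) ''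
              Inn (Subgroup.connectedComponentOfOne (PlaneSemi (GammaFin k))) ⊆
            Inn (Subgroup.connectedComponentOfOne (PlaneSemi GammaZ)) :=
  ⟨⟨borelReducible_gammaFin_gammaZ (by omega), not_borelReducible_gammaZ_gammaFin (by omega)⟩,
    not_exists_isomorphism hk⟩
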